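/- Let $\nu\ge 0$ and let $(\kappa_k)_{k\ge1}$ be positive reals with $\kappa_k\asymp k^{-\nu}$, i.e. $c\,k^{-\nu}\le\kappa_k\le C\,k^{-\nu}$ for all $k\ge1$ and some constants $0<c\le C$. For $f=(f_k)_{k\ge1}$ and $n\ge1$ let $P_f^{(n)}$ be the law of $X^{(n)}=(X_k)_{k\ge1}$, where the $X_k\sim\mathcal N(\kappa_kf_k,1/n)$ are independent; $E_{f_0}$ denotes expectation when $X^{(n)}\sim P_{f_0}^{(n)}$. Let $H$ be a probability distribution on $\mathbb R$ with a density $h$ that is symmetric, positive, bounded and decreasing on $[0,\infty)$, such that for some $c_1>0$ and $\varrho\ge0$ $$\log(1/h(x))\le c_1\bigl(1+\log^{1+\varrho}(1+x)\bigr)\quad (x\ge0),\qquad \int_{\mathbb R}x^2h(x)\,dx<\infty .$$ For a positive sequence $(\sigma_k)$ let $\Pi$ be the law of $f=(\sigma_k\zeta_k)_{k\ge1}$ with $\zeta_k$ i.i.d. of law $H$, and let $\Pi[\,\cdot\mid X^{(n)}]$ be the posterior, i.e. the conditional law of $f$ given $X^{(n)}$ when $f\sim\Pi$ and $X^{(n)}\mid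 f\sim P_f^{(n)}$. Write $\|f\|_2^2=\sum_kf_k^2$. Let $\beta,L>0$ and $\mathcal S^\beta(L)=\{f:\sum_{k\ge1}k^{2\beta}f_k^2\le L^2\}$. (i) If $\sigma_k=e^{-(\log k)^2}$ (the oversmoothed heavy-tailed, OT, prior), then there is $d>0$ such that for every $f_0\in\mathcal S^\beta(L)$, as $n\to\infty$, $$E_{f_0}\,\Pi\Bigl[\bigl\{f:\ \|f-f_0\|_2>(\log n)^d\,n^{-\beta/(2\beta+2\nu+1)}\bigr\}\,\Big|\,X^{(n)}\Bigr]\to0 .$$ (ii) The same holds, with a possibly different $d>0$, if $\sigma_k=k^{-1/2-\alpha}$ (the HT$(\alpha)$ prior) with $\alpha\ge\beta$. -/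

import Mathlib

open MeasureTheory ProbabilityTheory Filter Topology
open scoped ENNReal NNReal

/-! Sequences `(x_1, x_2, …)` are functions `ℕ → ℝ`; the entry `x_k`, `k ≥ 1`, is stored at
position `k - 1`, so that position `k` carries the index `k + 1`. -/

namespace SequenceModel

/-- The oversmoothing scales `σ_k = exp (-(log k)²)`, `k ≥ 1`. -/
noncomputable def otScale (k : ℕ) : ℝ := Real.exp (-(Real.log ((k : ℝ) + 1)) ^ 2)

/-- The polynomial scales `σ_k = k ^ (-1/2 - α)`, `k ≥ 1`. -/
noncomputable def htScale (α : ℝ) (k : ℕ) : ℝ := ((k : ℝ) + 1) ^ (-1 / 2 - α)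

/-- Conditions on the density `h`: symmetric, positive, bounded, decreasing on `[0, ∞)`, with
`log (1 / h x) ≤ c₁ (1 + log ^ (1 + ϱ) (1 + x))` for `x ≥ 0`. -/
structure IsHeavyTailed (h : ℝ → ℝ) (c₁ ϱ : ℝ) : Prop where
  symm : ∀ x, h (-x) = h x
  pos : ∀ x, 0 < h x
  bounded : ∃ M, ∀ x, h x ≤ M
  antitoneOn : AntitoneOn h (Set.Ici 0)
  tail : ∀ x, 0 ≤ x → Real.log (1 / h x) ≤ c₁ * (1 + Real.log (1 + x) ^ (1 + ϱ))

/-- `H` is the probability distribution on `ℝ` with Lebesgue density `h`. -/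
def HasDensity (H : Measure ℝ) (h : ℝ → ℝ) : Prop :=
  H = volume.withDensity (fun x => ENNReal.ofReal (h x))

/-- The series prior: the law of `(σ_k ζ_k)_k` with `ζ_k` independent of common law `H`. -/
noncomputable def prior (σ : ℕ → ℝ) (H : Measure ℝ) : Measure (ℕ → ℝ) :=
  Measure.infinitePi (fun k => H.map (fun z => σ k * z))

instance (σ : ℕ → ℝ) (H : Measure ℝ) [IsProbabilityMeasure H] :
    IsProbabilityMeasure (prior σ H) := by
  have : ∀ k, IsProbabilityMeasure (H.map (fun z => σ k * z)) := fun k =>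
    Measure.isProbabilityMeasure_map (by fun_prop)
  unfold prior
  infer_instance

/-- The law of the observation `X = (X_k)_k` given `f`: independent coordinates
`X_k ∼ N(κ_k f_k, 1/n)`. -/
noncomputable def obsLaw (κ : ℕ → ℝ) (n : ℕ) (f : ℕ → ℝ) : Measure (ℕ → ℝ) :=
  Measure.infinitePi (fun k => gaussianReal (κ k * f k) (n : ℝ≥0)⁻¹)

instance (κ : ℕ → ℝ) (n : ℕ) (f : ℕ → ℝ) : IsProbabilityMeasure (obsLaw κ n f) := by
  unfold obsLaw
  infer_instance

theorem measurable_obsLaw (κ : ℕ → ℝ) (n : ℕ) : Measurable (obsLaw κ n) := by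
  refine Measurable.measure_of_isPiSystem_of_isProbabilityMeasure
    (generateFrom_squareCylinders (α := fun _ : ℕ => ℝ)).symm
    (isPiSystem_squareCylinders (fun _ => MeasurableSpace.isPiSystem_measurableSet)
      (fun _ => MeasurableSet.univ (α := ℝ))) ?_
  rintro S ⟨s, t, ht, rfl⟩
  have hcyl : ∀ f, obsLaw κ n f ((s : Set ℕ).pi t)
      = ∏ i ∈ s, gaussianReal (κ i * f i) (n : ℝ≥0)⁻¹ (t i) := fun f =>
    Measure.infinitePi_pi (fun k => gaussianReal (κ k * f k) (n : ℝ≥0)⁻¹)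
      (fun i _ => ht i (Set.mem_univ i))
  simp only [hcyl]
  refine Finset.measurable_prod _ fun i _ => ?_
  have h0 : Measurable (fun f : ℕ → ℝ => (κ i * f i, (n : ℝ≥0)⁻¹)) := by fun_prop
  have h1 : Measurable (fun f : ℕ → ℝ => gaussianReal (κ i * f i) (n : ℝ≥0)⁻¹) :=
    measurable_gaussianReal.comp h0
  have hti : MeasurableSet (t i) := ht i (Set.mem_univ i)
  exact (Measure.measurable_coe hti).comp h1

/-- The sequence model `X_k | f ∼ N(κ_k f_k, 1/n)` as a Markov kernel from `f` to `X`. -/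
noncomputable def model (κ : ℕ → ℝ) (n : ℕ) : Kernel (ℕ → ℝ) (ℕ → ℝ) where
  toFun := obsLaw κ n
  measurable' := measurable_obsLaw κ n

instance (κ : ℕ → ℝ) (n : ℕ) : IsMarkovKernel (model κ n) :=
  ⟨fun f => inferInstanceAs (IsProbabilityMeasure (obsLaw κ n f))⟩

/-- `κ_k ≍ k ^ (-ν)`: the ratio lies between two positive constants for all `k ≥ 1`. -/
def HasIllPosedness (κ : ℕ → ℝ) (ν : ℝ) : Prop :=
  ∃ c C : ℝ, 0 < c ∧ 0 < C ∧
    ∀ k : ℕ, c * ((k : ℝ) + 1) ^ (-ν) ≤ κ k ∧ κ k ≤ C * ((k : ℝ) + 1) ^ (-ν)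

/-- The Sobolev ball `{f : ∑_{k ≥ 1} k ^ (2β) f_k² ≤ L²}`. -/
def sobolevBall (β L : ℝ) : Set (ℕ → ℝ) :=
  {f | Summable (fun k : ℕ => ((k : ℝ) + 1) ^ (2 * β) * f k ^ 2) ∧
    ∑' k : ℕ, ((k : ℝ) + 1) ^ (2 * β) * f k ^ 2 ≤ L ^ 2}

/-- The distance `‖f - g‖₂ = (∑ (f_k - g_k)²)^(1/2)`, with value `∞` if the series diverges. -/
noncomputable def l2Dist (f g : ℕ → ℝ) : ℝ≥0∞ :=
  (∑' k, ENNReal.ofReal ((f k - g k) ^ 2)) ^ (1 / 2 : ℝ)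

/-- Contraction of the posterior at rate `ε` around `f₀`:
`E_{f₀} Π[{f : ‖f - f₀‖₂ > ε_n} | X] → 0` as `n → ∞`, where `Π[· | X]` is the conditional law of
`f` given `X` when `f ∼ Π` and `X | f` follows the sequence model. -/
def PosteriorContracts (κ σ : ℕ → ℝ) (H : Measure ℝ) [IsProbabilityMeasure H]
    (f₀ : ℕ → ℝ) (ε : ℕ → ℝ) : Prop :=
  Tendsto
    (fun n : ℕ =>
      ∫⁻ X, posterior (model κ n) (prior σ H) X {f | ENNReal.ofReal (ε n) < l2Dist f f₀}
        ∂(model κ n f₀))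
    atTop (𝓝 0)

/-- The rate `(log n) ^ d * n ^ (-β / (2β + 2ν + 1))`. -/
noncomputable def rate (β ν d : ℝ) (n : ℕ) : ℝ :=
  Real.log n ^ d * (n : ℝ) ^ (-β / (2 * β + 2 * ν + 1))

end SequenceModel

open MeasureTheory ProbabilityTheory Filter Topology
open scoped ENNReal NNReal

/-! Prior and noise are independent across coordinates, so the posterior is a product of
one-dimensional posteriors (`piKernel_ae_eq_posterior`). It is determined only up to null sets of
the predictive law of `X`. A one-sided Kakutani criterion (`infinitePi_absolutelyContinuous`) shows
that the law of `X` under `f₀` charges no such set. Markov's inequality then reduces contraction to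
summing the coordinate risks (`lintegral_posterior_le_tsum_coordRisk`).

Each coordinate, with `a = κ k` and noise variance `v = 1/n`, has two risk bounds. Let `exp (-Λ)` be
a lower bound for the prior mass of a neighbourhood of `f₀ k` of width `√v / a` or less. Jensen's
inequality for `-t log t` gives a risk of order `(v / a²) (Λ + 1)`, as in a parametric problem
(`coordRisk_le_parametric`). If the prior variance is also below noise level, a change of measure to
the predictive law gives the prior variance plus `f₀ k ^ 2 (Λ + 1)`, up to constants
(`coordRisk_le_prior`).

Heavy tails matter through `Λ`. A fixed point seen at scale `σ k` costs only a power of `log (1 / σ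
k)`, so `Λ` is polylogarithmic in `n` and `k` even when the prior oversmooths
(`exp_neg_le_coordPrior_ball`). The parametric bound is used for `k ≤ n ^ (1 / (2β + 2ν + 1))` and
the other bound beyond. There the prior variances are at most of order `k ^ (-1 - 2β)`, and Sobolev
regularity controls the signal (`exists_tsum_le_of_cutoff`). The extra logarithms in the rate make
the quotient vanish. -/

namespace SequenceModel

/-! ### Infinite product models: factorization of the posterior and absolute continuity. -/

section Product

variable {ι : Type*} {Ω 𝓧 : ι → Type*} [∀ i, MeasurableSpace (Ω i)] [∀ i, MeasurableSpace (𝓧 i)]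

theorem lintegral_prod_infinitePi (μ : ∀ i, Measure (Ω i)) [∀ i, IsProbabilityMeasure (μ i)]
    (s : Finset ι) {u : ∀ i, Ω i → ℝ≥0∞} (hu : ∀ i, Measurable (u i)) :
    ∫⁻ f, ∏ i ∈ s, u i (f i) ∂(Measure.infinitePi μ) = ∏ i ∈ s, ∫⁻ x, u i x ∂(μ i) := by
  refine (lintegral_prod_eq_prod_lintegral_of_indepFun s (fun i (f : ∀ i, Ω i) => u i (f i))
    (iIndepFun_infinitePi hu) (fun i => (hu i).comp (measurable_pi_apply i))).trans ?_
  refine Finset.prod_congr rfl fun i _ => ?_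
  rw [← Measure.infinitePi_map_eval μ i, lintegral_map (hu i) (by fun_prop)]

/-- The product of a family of Markov kernels, acting coordinate by coordinate. -/
noncomputable def piKernel (g : ∀ i, Kernel (Ω i) (𝓧 i)) [∀ i, IsMarkovKernel (g i)] :
    Kernel (∀ i, Ω i) (∀ i, 𝓧 i) where
  toFun f := Measure.infinitePi fun i => g i (f i)
  measurable' := by
    refine Measurable.measure_of_isPiSystem_of_isProbabilityMeasure
      (generateFrom_squareCylinders (α := 𝓧)).symm
      (isPiSystem_squareCylinders (fun _ => MeasurableSpace.isPiSystem_measurableSet)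
        (fun _ => MeasurableSet.univ)) ?_
    rintro S ⟨s, t, ht, rfl⟩
    have hcyl : ∀ f : ∀ i, Ω i, Measure.infinitePi (fun i => g i (f i)) ((s : Set ι).pi t)
        = ∏ i ∈ s, g i (f i) (t i) := fun f =>
      Measure.infinitePi_pi (fun i => g i (f i)) (fun i _ => ht i (Set.mem_univ i))
    simp only [hcyl]
    exact Finset.measurable_prod _ fun i _ =>
      ((g i).measurable_coe (ht i (Set.mem_univ i))).comp (measurable_pi_apply i)

theorem piKernel_apply (g : ∀ i, Kernel (Ω i) (𝓧 i)) [∀ i, IsMarkovKernel (g i)]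
    (f : ∀ i, Ω i) : piKernel g f = Measure.infinitePi fun i => g i (f i) := rfl

instance (g : ∀ i, Kernel (Ω i) (𝓧 i)) [∀ i, IsMarkovKernel (g i)] :
    IsMarkovKernel (piKernel g) :=
  ⟨fun f => by rw [piKernel_apply]; infer_instance⟩

/-- The pairs (parameter, observation) are independent across coordinates. It suffices to check
finite boxes, where the integral of a product factors. -/
theorem map_zip_compProd_piKernel (μ : ∀ i, Measure (Ω i)) [∀ i, IsProbabilityMeasure (μ i)]
    (g : ∀ i, Kernel (Ω i) (𝓧 i)) [∀ i, IsMarkovKernel (g i)] :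
    (Measure.infinitePi μ ⊗ₘ piKernel g).map (fun p i => (p.1 i, p.2 i))
      = Measure.infinitePi fun i => μ i ⊗ₘ g i := by
  refine Measure.eq_infinitePi _ fun s t ht => ?_
  have hm : Measurable fun (p : (∀ i, Ω i) × (∀ i, 𝓧 i)) (i : ι) => (p.1 i, p.2 i) := by fun_prop
  have hpi : MeasurableSet ((s : Set ι).pi t) := .pi s.countable_toSet fun i _ => ht i
  rw [Measure.map_apply hm hpi, Measure.compProd_apply (hm hpi)]
  have h1 : ∀ f : ∀ i, Ω i, piKernel g f
      (Prod.mk f ⁻¹' ((fun p i => (p.1 i, p.2 i)) ⁻¹' ((s : Set ι).pi t)))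
      = ∏ i ∈ s, g i (f i) (Prod.mk (f i) ⁻¹' t i) := fun f => by
    have : (Prod.mk f ⁻¹' ((fun (p : (∀ i, Ω i) × (∀ i, 𝓧 i)) i => (p.1 i, p.2 i)) ⁻¹'
        ((s : Set ι).pi t))) = (s : Set ι).pi fun i => Prod.mk (f i) ⁻¹' t i := by
      ext x; simp
    rw [this, piKernel_apply, Measure.infinitePi_pi]
    exact fun i _ => measurable_prodMk_left (ht i)
  simp only [h1]
  rw [lintegral_prod_infinitePi μ s (u := fun i x => g i x (Prod.mk x ⁻¹' t i))
    (fun i => Kernel.measurable_kernel_prodMk_left (ht i))]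
  exact Finset.prod_congr rfl fun i _ => (Measure.compProd_apply (ht i)).symm

theorem compProd_piKernel (μ : ∀ i, Measure (Ω i)) [∀ i, IsProbabilityMeasure (μ i)]
    (g : ∀ i, Kernel (Ω i) (𝓧 i)) [∀ i, IsMarkovKernel (g i)] :
    Measure.infinitePi μ ⊗ₘ piKernel g
      = (Measure.infinitePi fun i => μ i ⊗ₘ g i).map
          (fun p => (fun i => (p i).1, fun i => (p i).2)) := by
  rw [← map_zip_compProd_piKernel, Measure.map_map (by fun_prop) (by fun_prop)]
  exact Measure.map_id.symm

theorem comp_piKernel (μ : ∀ i, Measure (Ω i)) [∀ i, IsProbabilityMeasure (μ i)]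
    (g : ∀ i, Kernel (Ω i) (𝓧 i)) [∀ i, IsMarkovKernel (g i)] :
    piKernel g ∘ₘ Measure.infinitePi μ = Measure.infinitePi fun i => g i ∘ₘ μ i := by
  rw [← Measure.snd_compProd, compProd_piKernel, Measure.snd, Measure.map_map (by fun_prop)
    (by fun_prop)]
  have := Measure.infinitePi_map_pi (fun i => μ i ⊗ₘ g i) (f := fun _ => Prod.snd)
    (fun _ => measurable_snd)
  simp only [← Measure.snd_compProd]
  exact this

/-- In a product model with a product prior, the product of the coordinate posteriors is a
version of the posterior. -/
theorem piKernel_ae_eq_posterior [Countable ι] [∀ i, StandardBorelSpace (Ω i)]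
    [∀ i, Nonempty (Ω i)]
    (μ : ∀ i, Measure (Ω i)) [∀ i, IsProbabilityMeasure (μ i)]
    (g : ∀ i, Kernel (Ω i) (𝓧 i)) [∀ i, IsMarkovKernel (g i)]
    (q : ∀ i, Kernel (𝓧 i) (Ω i)) [∀ i, IsMarkovKernel (q i)]
    (hq : ∀ i, (g i ∘ₘ μ i) ⊗ₘ q i = (μ i ⊗ₘ g i).map Prod.swap) :
    piKernel q =ᵐ[Measure.infinitePi fun i => g i ∘ₘ μ i]
      posterior (piKernel g) (Measure.infinitePi μ) := by
  rw [← comp_piKernel]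
  refine ae_eq_posterior_of_compProd_eq ?_
  rw [comp_piKernel, compProd_piKernel, compProd_piKernel, Measure.map_map (by fun_prop)
    (by fun_prop)]
  have : (Measure.infinitePi fun i => (g i ∘ₘ μ i) ⊗ₘ q i)
      = (Measure.infinitePi fun i => μ i ⊗ₘ g i).map (fun p i => (p i).swap) := by
    rw [Measure.infinitePi_map_pi _ (f := fun _ => Prod.swap) (fun _ => measurable_swap)]
    simp only [hq]
  rw [this, Measure.map_map (by fun_prop) (by fun_prop)]
  rfl

theorem isSetAlgebra_measurableCylinders : IsSetAlgebra (measurableCylinders Ω) where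
  empty_mem := empty_mem_measurableCylinders Ω
  compl_mem _ h := compl_mem_measurableCylinders h
  union_mem _ _ h h' := union_mem_measurableCylinders h h'

/-- No infinite product density is needed on a cylinder: after restriction to `s` both sides are
finite products, which agree on boxes. -/
theorem infinitePi_apply_of_withDensity (μ ν : ∀ i, Measure (Ω i))
    [∀ i, IsProbabilityMeasure (μ i)] [∀ i, IsProbabilityMeasure (ν i)]
    {r : ∀ i, Ω i → ℝ≥0∞} (hr : ∀ i, Measurable (r i)) (hμ : ∀ i, μ i = (ν i).withDensity (r i))
    (s : Finset ι) {S : Set (∀ i : s, Ω i)} (hS : MeasurableSet S) :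
    Measure.infinitePi μ (cylinder s S)
      = ∫⁻ x in cylinder s S, ∏ i ∈ s, r i (x i) ∂(Measure.infinitePi ν) := by
  classical
  have hrest : Measurable (s.restrict : (∀ i, Ω i) → ∀ i : s, Ω i) := Finset.measurable_restrict s
  have hC : MeasurableSet (cylinder s S) := hrest hS
  have key : ((Measure.infinitePi ν).withDensity fun x => ∏ i ∈ s, r i (x i)).map s.restrict
      = Measure.pi fun i : s => μ i := by
    refine (Measure.pi_eq fun t ht => ?_).symm
    rw [Measure.map_apply hrest (.univ_pi ht), withDensity_apply _ (hrest (.univ_pi ht)),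
      ← lintegral_indicator (hrest (.univ_pi ht))]
    -- `Set.univ` is a filler off `s`; only coordinates in `s` enter the product.
    let t' : ∀ i, Set (Ω i) := fun i => if hi : i ∈ s then t ⟨i, hi⟩ else Set.univ
    have ht' : ∀ i, MeasurableSet (t' i) := fun i => by
      by_cases hi : i ∈ s <;> simp [t', hi, ht]
    have h1 : (s.restrict ⁻¹' (Set.univ.pi t)).indicator (fun x => ∏ i ∈ s, r i (x i))
        = fun x => ∏ i ∈ s, (t' i).indicator (r i) (x i) := by
      ext x
      by_cases hx : x ∈ s.restrict ⁻¹' (Set.univ.pi t)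
      · rw [Set.indicator_of_mem hx]
        refine Finset.prod_congr rfl fun i hi => ?_
        rw [Set.indicator_of_mem]
        have := hx ⟨i, hi⟩ (Set.mem_univ _)
        simpa [t', hi] using this
      · rw [Set.indicator_of_notMem hx]
        simp only [Set.mem_preimage, Set.mem_pi, Set.mem_univ, forall_const, not_forall] at hx
        obtain ⟨⟨i, hi⟩, hx⟩ := hx
        refine (Finset.prod_eq_zero hi ?_).symm
        rw [Set.indicator_of_notMem]
        simpa [t', hi] using hx
    rw [h1, lintegral_prod_infinitePi ν s fun i => (hr i).indicator (ht' i), ← Finset.prod_attach]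
    refine Finset.prod_congr rfl fun i _ => ?_
    rw [lintegral_indicator (ht' i), hμ, withDensity_apply _ (ht i)]
    simp [t']
  rw [← withDensity_apply _ hC, cylinder, ← Measure.map_apply hrest hS,
    ← Measure.map_apply hrest hS, key, Measure.infinitePi_map_restrict]

/-- A sufficient condition for absolute continuity of infinite products: the second moments of
the coordinate densities have bounded finite products. -/
theorem infinitePi_absolutelyContinuous (μ ν : ∀ i, Measure (Ω i))
    [∀ i, IsProbabilityMeasure (μ i)] [∀ i, IsProbabilityMeasure (ν i)]
    {r : ∀ i, Ω i → ℝ≥0∞} (hr : ∀ i, Measurable (r i)) (hμ : ∀ i, μ i = (ν i).withDensity (r i))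
    (K : ℝ≥0∞) (hK : K ≠ ∞) (hrK : ∀ s : Finset ι, ∏ i ∈ s, ∫⁻ x, r i x ^ 2 ∂(ν i) ≤ K) :
    Measure.infinitePi μ ≪ Measure.infinitePi ν := by
  set P := Measure.infinitePi μ
  set Q := Measure.infinitePi ν
  -- Cauchy–Schwarz for the finite product density against the indicator of the cylinder; `K` does
  -- not depend on the cylinder.
  have hcyl : ∀ C ∈ measurableCylinders Ω, P C ^ 2 ≤ K * Q C := by
    intro C hC
    obtain ⟨s, S, hS, rfl⟩ := (mem_measurableCylinders C).1 hC
    have hm : Measurable fun x : ∀ i, Ω i => ∏ i ∈ s, r i (x i) :=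
      Finset.measurable_prod _ fun i _ => (hr i).comp (measurable_pi_apply i)
    have hCm : MeasurableSet (cylinder s S) := Finset.measurable_restrict s hS
    have h2 : P (cylinder s S) ≤ (∫⁻ x, (∏ i ∈ s, r i (x i)) ^ (2 : ℝ) ∂Q) ^ (1 / 2 : ℝ)
        * (∫⁻ x, ((cylinder s S).indicator 1 x) ^ (2 : ℝ) ∂Q) ^ (1 / 2 : ℝ) := by
      rw [infinitePi_apply_of_withDensity μ ν hr hμ s hS, ← lintegral_indicator hCm]
      refine le_trans (le_of_eq ?_) (ENNReal.lintegral_mul_le_Lp_mul_Lq Q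
        Real.HolderConjugate.two_two hm.aemeasurable
        (measurable_one.indicator hCm).aemeasurable)
      congr 1 with x
      by_cases hx : x ∈ cylinder s S <;> simp [hx]
    have h3 : ∫⁻ x, (∏ i ∈ s, r i (x i)) ^ (2 : ℝ) ∂Q ≤ K := by
      refine le_trans (le_of_eq ?_) (hrK s)
      rw [← lintegral_prod_infinitePi ν s fun i => (hr i).pow_const 2]
      congr 1 with x
      rw [Finset.prod_pow]
      norm_cast
    have h4 : ∫⁻ x, ((cylinder s S).indicator 1 x) ^ (2 : ℝ) ∂Q = Q (cylinder s S) := by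
      rw [← lintegral_indicator_one hCm]
      congr 1 with x
      by_cases hx : x ∈ cylinder s S <;> simp [hx]
    rw [h4] at h2
    calc P (cylinder s S) ^ 2 ≤ (K ^ (1 / 2 : ℝ) * Q (cylinder s S) ^ (1 / 2 : ℝ)) ^ 2 := by
          gcongr
          exact h2.trans (by gcongr)
      _ = K * Q (cylinder s S) := by
          rw [mul_pow, ← ENNReal.rpow_natCast, ← ENNReal.rpow_natCast, ← ENNReal.rpow_mul,
            ← ENNReal.rpow_mul]
          norm_num
  refine Measure.AbsolutelyContinuous.mk fun E hE hQE => ?_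
  -- Approximation under `P + Q` makes one cylinder close to `E` for both measures at once, so the
  -- cylinder inequality passes to a `Q`-null set `E` as `ε → 0`.
  have hdense : (P + Q).MeasureDense (measurableCylinders Ω) :=
    .of_generateFrom_isSetAlgebra_finite _ isSetAlgebra_measurableCylinders
      generateFrom_measurableCylinders.symm
  have hbound : ∀ ε : ℝ, 0 < ε → P E ^ 2 ≤ 2 * ENNReal.ofReal ε ^ 2 + 2 * K * ENNReal.ofReal ε := by
    intro ε hε
    obtain ⟨C, hC, hd⟩ := hdense.approx E hE (measure_ne_top _ _) ε hε
    rw [Measure.add_apply] at hd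
    have hP : P E ≤ ENNReal.ofReal ε + P C := by
      calc P E ≤ P (symmDiff E C ∪ C) := measure_mono fun x hx => by
            by_cases h : x ∈ C
            · exact Or.inr h
            · exact Or.inl (Or.inl ⟨hx, h⟩)
        _ ≤ P (symmDiff E C) + P C := measure_union_le _ _
        _ ≤ _ := by gcongr; exact (le_self_add.trans hd.le)
    have hQ : Q C ≤ ENNReal.ofReal ε := by
      calc Q C ≤ Q (symmDiff E C ∪ E) := measure_mono fun x hx => by
            by_cases h : x ∈ E
            · exact Or.inr h
            · exact Or.inl (Or.inr ⟨hx, h⟩)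
        _ ≤ Q (symmDiff E C) + Q E := measure_union_le _ _
        _ ≤ _ := by rw [hQE, add_zero]; exact (le_add_self.trans hd.le)
    calc P E ^ 2 ≤ (ENNReal.ofReal ε + P C) ^ 2 := by gcongr
      _ ≤ 2 * (ENNReal.ofReal ε ^ 2 + P C ^ 2) := by
          have h := ENNReal.rpow_add_le_mul_rpow_add_rpow (ENNReal.ofReal ε) (P C) one_le_two
          norm_num at h
          exact_mod_cast h
      _ ≤ 2 * (ENNReal.ofReal ε ^ 2 + K * ENNReal.ofReal ε) := by
          gcongr
          exact (hcyl C hC).trans (by gcongr)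
      _ = _ := by ring
  have hlim : Tendsto (fun ε : ℝ => 2 * ENNReal.ofReal ε ^ 2 + 2 * K * ENNReal.ofReal ε)
      (𝓝[>] 0) (𝓝 (2 * ENNReal.ofReal 0 ^ 2 + 2 * K * ENNReal.ofReal 0)) := by
    have h0 : Tendsto ENNReal.ofReal (𝓝[>] 0) (𝓝 (ENNReal.ofReal 0)) :=
      (ENNReal.continuous_ofReal.tendsto 0).mono_left nhdsWithin_le_nhds
    refine Tendsto.add (ENNReal.Tendsto.const_mul ?_ (by simp))
      (ENNReal.Tendsto.const_mul h0 (Or.inr (by finiteness)))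
    exact ((ENNReal.continuous_pow 2).tendsto _).comp h0
  have h0 : P E ^ 2 ≤ 2 * ENNReal.ofReal 0 ^ 2 + 2 * K * ENNReal.ofReal 0 :=
    ge_of_tendsto hlim (by filter_upwards [self_mem_nhdsWithin] with ε hε using hbound ε hε)
  simpa using h0

end Product

/-! ### The one-dimensional Gaussian model and Bayes' formula. -/

section Coordinate

/-- The Gaussian likelihood of `f` at the observation `x ∼ N(a f, v)`, up to normalization. -/
noncomputable def lik (a : ℝ) (v : ℝ≥0) (x f : ℝ) : ℝ := Real.exp (-(x - a * f) ^ 2 / (2 * v))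

/-- The integrated likelihood. -/
noncomputable def evid (μ : Measure ℝ) (a : ℝ) (v : ℝ≥0) (x : ℝ) : ℝ := ∫ f, lik a v x f ∂μ

/-- The one-dimensional Gaussian observation kernel `f ↦ N(a f, v)`. -/
noncomputable def gaussKernel (a : ℝ) (v : ℝ≥0) : Kernel ℝ ℝ where
  toFun f := gaussianReal (a * f) v
  measurable' := measurable_gaussianReal.comp (by fun_prop : Measurable fun f : ℝ => (a * f, v))

instance (a : ℝ) (v : ℝ≥0) : IsMarkovKernel (gaussKernel a v) :=
  ⟨fun f => inferInstanceAs (IsProbabilityMeasure (gaussianReal (a * f) v))⟩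

theorem gaussKernel_apply (a : ℝ) (v : ℝ≥0) (f : ℝ) :
    gaussKernel a v f = gaussianReal (a * f) v := rfl

variable (μ : Measure ℝ) [IsProbabilityMeasure μ] (a : ℝ) (v : ℝ≥0)

theorem measurable_uncurry_lik : Measurable (Function.uncurry (lik a v)) := by
  unfold Function.uncurry lik
  fun_prop

theorem lik_pos (x f : ℝ) : 0 < lik a v x f := Real.exp_pos _

theorem lik_le_one (x f : ℝ) : lik a v x f ≤ 1 := by
  rw [lik, Real.exp_le_one_iff, neg_div]
  have : 0 ≤ (x - a * f) ^ 2 / (2 * (v : ℝ)) := by positivity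
  linarith

theorem measurable_lik (x : ℝ) : Measurable (lik a v x) :=
  (measurable_uncurry_lik a v).comp measurable_prodMk_left

theorem integrable_lik (x : ℝ) : Integrable (lik a v x) μ :=
  .of_bound (measurable_lik a v x).aestronglyMeasurable 1 (.of_forall fun f => by
    rw [Real.norm_of_nonneg (lik_pos a v x f).le]; exact lik_le_one a v x f)

theorem evid_pos (x : ℝ) : 0 < evid μ a v x := by
  rw [evid, integral_pos_iff_support_of_nonneg (fun f => (lik_pos a v x f).le)
    (integrable_lik μ a v x)]
  have : Function.support (lik a v x) = Set.univ := by
    ext f; simp [(lik_pos a v x f).ne']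
  simp [this]

theorem measurable_evid : Measurable (evid μ a v) :=
  (measurable_uncurry_lik a v).stronglyMeasurable.integral_prod_right.measurable

theorem lintegral_lik (x : ℝ) :
    ∫⁻ f, ENNReal.ofReal (lik a v x f) ∂μ = ENNReal.ofReal (evid μ a v x) :=
  (ofReal_integral_eq_lintegral_ofReal (integrable_lik μ a v x)
    (.of_forall fun f => (lik_pos a v x f).le)).symm

/-- The posterior of one coordinate, with density proportional to the likelihood with respect to
the prior. -/
noncomputable def coordPosterior : Kernel ℝ ℝ :=
  (Kernel.const ℝ μ).withDensity fun x f => ENNReal.ofReal (lik a v x f / evid μ a v x)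

theorem measurable_uncurry_posteriorDensity : Measurable (Function.uncurry fun x f =>
    ENNReal.ofReal (lik a v x f / evid μ a v x)) :=
  ((measurable_uncurry_lik a v).div ((measurable_evid μ a v).comp measurable_fst)).ennreal_ofReal

theorem coordPosterior_apply (x : ℝ) : coordPosterior μ a v x
    = μ.withDensity fun f => ENNReal.ofReal (lik a v x f / evid μ a v x) := by
  rw [coordPosterior, Kernel.withDensity_apply _ (measurable_uncurry_posteriorDensity μ a v),
    Kernel.const_apply]

omit [IsProbabilityMeasure μ] in
theorem measurable_posteriorDensity (x : ℝ) : Measurable fun f =>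
    ENNReal.ofReal (lik a v x f / evid μ a v x) :=
  ((measurable_lik a v x).div_const _).ennreal_ofReal

instance : IsMarkovKernel (coordPosterior μ a v) := by
  refine ⟨fun x => ⟨?_⟩⟩
  rw [coordPosterior_apply, withDensity_apply _ .univ, Measure.restrict_univ]
  have h := evid_pos μ a v x
  simp_rw [div_eq_mul_inv, ENNReal.ofReal_mul (lik_pos a v x _).le]
  rw [lintegral_mul_const _ (measurable_lik a v x).ennreal_ofReal, lintegral_lik,
    ← ENNReal.ofReal_mul h.le, mul_inv_cancel₀ h.ne', ENNReal.ofReal_one]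

theorem lintegral_coordPosterior (x : ℝ) {u : ℝ → ℝ} (hu : Measurable u) :
    ∫⁻ f, ENNReal.ofReal (u f) ∂(coordPosterior μ a v x)
      = ∫⁻ f, ENNReal.ofReal (lik a v x f / evid μ a v x * u f) ∂μ := by
  rw [coordPosterior_apply, lintegral_withDensity_eq_lintegral_mul _
    (measurable_posteriorDensity μ a v x) hu.ennreal_ofReal]
  congr 1 with f
  rw [Pi.mul_apply, ← ENNReal.ofReal_mul (div_nonneg (lik_pos a v x f).le (evid_pos μ a v x).le)]

variable {v} (hv : v ≠ 0)

include hv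

theorem gaussianPDF_eq_lik (f x : ℝ) : gaussianPDF (a * f) v x
    = ENNReal.ofReal (√(2 * Real.pi * v))⁻¹ * ENNReal.ofReal (lik a v x f) := by
  rw [gaussianPDF, gaussianPDFReal, lik, ENNReal.ofReal_mul (by positivity)]

theorem gaussKernel_eq_withDensity (f : ℝ) : gaussKernel a v f = volume.withDensity fun x =>
    ENNReal.ofReal (√(2 * Real.pi * v))⁻¹ * ENNReal.ofReal (lik a v x f) := by
  rw [gaussKernel_apply, gaussianReal_of_var_ne_zero _ hv]
  congr 1 with x
  exact gaussianPDF_eq_lik a hv f x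

theorem comp_gaussKernel : gaussKernel a v ∘ₘ μ = volume.withDensity fun x =>
    ENNReal.ofReal (√(2 * Real.pi * v))⁻¹ * ENNReal.ofReal (evid μ a v x) := by
  ext s hs
  have hm : Measurable (Function.uncurry fun f x =>
      ENNReal.ofReal (√(2 * Real.pi * v))⁻¹ * ENNReal.ofReal (lik a v x f)) :=
    ((measurable_uncurry_lik a v).comp measurable_swap).ennreal_ofReal.const_mul _
  rw [Measure.bind_apply hs (Kernel.aemeasurable _), withDensity_apply _ hs]
  simp_rw [gaussKernel_eq_withDensity a hv, withDensity_apply _ hs]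
  rw [lintegral_lintegral_swap hm.aemeasurable]
  refine lintegral_congr fun x => ?_
  rw [lintegral_const_mul _ (measurable_lik a v x).ennreal_ofReal, lintegral_lik]

/-- Bayes' formula: the evidence cancels, and both sides have the same density, a constant times the
likelihood, with respect to `volume` times `μ`. Tonelli exchanges the order of integration. -/
theorem compProd_coordPosterior :
    (gaussKernel a v ∘ₘ μ) ⊗ₘ coordPosterior μ a v = (μ ⊗ₘ gaussKernel a v).map Prod.swap := by
  ext s hs
  set c := ENNReal.ofReal (√(2 * Real.pi * v))⁻¹
  have hl := measurable_uncurry_lik a v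
  have hsx : ∀ x, MeasurableSet (Prod.mk x ⁻¹' s) := fun x => measurable_prodMk_left hs
  have hsf : ∀ f, MeasurableSet {x | (x, f) ∈ s} := fun f => measurable_prodMk_right hs
  rw [Measure.compProd_apply hs, Measure.map_apply measurable_swap hs,
    Measure.compProd_apply (measurable_swap hs), comp_gaussKernel μ a hv,
    lintegral_withDensity_eq_lintegral_mul _
      ((measurable_evid μ a v).ennreal_ofReal.const_mul _) (Kernel.measurable_kernel_prodMk_left hs)]
  have h1 : ∀ f, gaussKernel a v f (Prod.mk f ⁻¹' (Prod.swap ⁻¹' s))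
      = ∫⁻ x, s.indicator (fun p => c * ENNReal.ofReal (lik a v p.1 p.2)) (x, f) := fun f => by
    have : Prod.mk f ⁻¹' (Prod.swap ⁻¹' s) = {x | (x, f) ∈ s} := rfl
    rw [this, gaussKernel_eq_withDensity a hv, withDensity_apply _ (hsf f),
      ← lintegral_indicator (hsf f)]
    rfl
  have h2 : ∀ x, ((fun x => c * ENNReal.ofReal (evid μ a v x)) *
      fun x => coordPosterior μ a v x (Prod.mk x ⁻¹' s)) x
      = ∫⁻ f, s.indicator (fun p => c * ENNReal.ofReal (lik a v p.1 p.2)) (x, f) ∂μ := fun x => by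
    have he := evid_pos μ a v x
    rw [Pi.mul_apply, coordPosterior_apply, withDensity_apply _ (hsx x), ← lintegral_const_mul _
      (measurable_posteriorDensity μ a v x), ← lintegral_indicator (hsx x)]
    congr 1 with f
    have : c * ENNReal.ofReal (evid μ a v x) * ENNReal.ofReal (lik a v x f / evid μ a v x)
        = c * ENNReal.ofReal (lik a v x f) := by
      rw [mul_assoc, ← ENNReal.ofReal_mul he.le, mul_div_cancel₀ _ he.ne']
    by_cases hf : (x, f) ∈ s
    · rw [Set.indicator_of_mem (by exact hf), Set.indicator_of_mem hf, this]
    · rw [Set.indicator_of_notMem (by exact hf), Set.indicator_of_notMem hf]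
  refine (lintegral_congr h2).trans (Eq.trans ?_ (lintegral_congr h1).symm)
  refine lintegral_lintegral_swap (f := fun x f =>
    s.indicator (fun p => c * ENNReal.ofReal (lik a v p.1 p.2)) (x, f)) ?_
  exact ((hl.ennreal_ofReal.const_mul c).indicator hs).aemeasurable

theorem comp_coordPosterior : coordPosterior μ a v ∘ₘ (gaussKernel a v ∘ₘ μ) = μ := by
  rw [← Measure.snd_compProd, compProd_coordPosterior μ a hv, Measure.snd_map_swap,
    Measure.fst_compProd]

/-- This change of measure serves both the absolute continuity of the observation law and the risk
bound for small signals. -/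
theorem gaussianReal_eq_withDensity_predictive (f₀ : ℝ) : gaussianReal (a * f₀) v
    = (gaussKernel a v ∘ₘ μ).withDensity fun x =>
        ENNReal.ofReal (lik a v x f₀ / evid μ a v x) := by
  have hl : Measurable fun x => lik a v x f₀ :=
    (measurable_uncurry_lik a v).comp measurable_prodMk_right
  have hd : Measurable fun x => ENNReal.ofReal (lik a v x f₀ / evid μ a v x) :=
    (hl.div (measurable_evid μ a v)).ennreal_ofReal
  rw [comp_gaussKernel μ a hv, ← withDensity_mul _
    ((measurable_evid μ a v).ennreal_ofReal.const_mul _) hd, ← gaussKernel_apply,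
    gaussKernel_eq_withDensity a hv]
  congr 1 with x
  have he := evid_pos μ a v x
  rw [Pi.mul_apply, mul_assoc (ENNReal.ofReal _), ← ENNReal.ofReal_mul he.le,
    mul_div_cancel₀ _ he.ne']

/-- Gibbs' variational inequality for the Gaussian log-likelihood. -/
theorem integral_lik_mul_sq_le (x : ℝ) :
    Integrable (fun f => lik a v x f * (x - a * f) ^ 2) μ ∧
      ∫ f, lik a v x f * (x - a * f) ^ 2 ∂μ
        ≤ 2 * v * (evid μ a v x * -Real.log (evid μ a v x)) := by
  have hv' : (0 : ℝ) < v := by positivity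
  -- The squared residual is `2v` times minus the log-likelihood, so the weighted residual is `2v *
  -- negMulLog (lik)` and concavity of `negMulLog` applies.
  have hneg : ∀ f, Real.negMulLog (lik a v x f)
      = (2 * (v : ℝ))⁻¹ * (lik a v x f * (x - a * f) ^ 2) := fun f => by
    rw [Real.negMulLog, lik, Real.log_exp]
    field_simp
  have hint : Integrable (Real.negMulLog ∘ lik a v x) μ := by
    refine .of_bound (Real.continuous_negMulLog.measurable.comp
      (measurable_lik a v x)).aestronglyMeasurable 1 (.of_forall fun f => ?_)
    have h0 := lik_pos a v x f
    have h1 := lik_le_one a v x f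
    rw [Function.comp, Real.norm_of_nonneg (Real.negMulLog_nonneg h0.le h1), Real.negMulLog]
    have := Real.one_sub_inv_le_log_of_pos h0
    have h3 := mul_le_mul_of_nonneg_left this h0.le
    rw [mul_sub, mul_inv_cancel₀ h0.ne'] at h3
    linarith
  have hJ := Real.concaveOn_negMulLog.le_map_integral Real.continuous_negMulLog.continuousOn
    isClosed_Ici (.of_forall fun f => (lik_pos a v x f).le) (integrable_lik μ a v x) hint
  have heq : (fun f => lik a v x f * (x - a * f) ^ 2)
      = fun f => 2 * (v : ℝ) * (Real.negMulLog ∘ lik a v x) f := by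
    ext f
    rw [Function.comp, hneg]
    field_simp
  refine ⟨heq ▸ hint.const_mul _, ?_⟩
  rw [heq, integral_const_mul]
  refine mul_le_mul_of_nonneg_left (hJ.trans (le_of_eq ?_)) (by positivity)
  rw [Real.negMulLog, ← evid]
  ring

end Coordinate

/-! ### Risk bounds for a single coordinate. -/

section CoordinateRisk

variable (μ : Measure ℝ) [IsProbabilityMeasure μ] (a : ℝ) {v : ℝ≥0} (hv : v ≠ 0)

include hv

theorem evid_ge_of_small_ball {f₀ : ℝ} {I : Set ℝ} (hI : MeasurableSet I)
    (hIf : ∀ f ∈ I, a ^ 2 * (f - f₀) ^ 2 ≤ v) (x : ℝ) :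
    μ.real I * Real.exp (-((x - a * f₀) ^ 2 / v + 1)) ≤ evid μ a v x := by
  have hv' : (0 : ℝ) < v := by positivity
  calc μ.real I * Real.exp (-((x - a * f₀) ^ 2 / v + 1))
      = ∫ _ in I, Real.exp (-((x - a * f₀) ^ 2 / v + 1)) ∂μ := by
        rw [setIntegral_const, smul_eq_mul]
    _ ≤ ∫ f in I, lik a v x f ∂μ := by
        refine setIntegral_mono_on (integrable_const _).integrableOn
          (integrable_lik μ a v x).integrableOn hI fun f hf => ?_
        rw [lik, Real.exp_le_exp, neg_div, neg_le_neg_iff, div_le_iff₀ (by positivity)]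
        have h1 := hIf f hf
        have h2 : (x - a * f) ^ 2 ≤ 2 * (x - a * f₀) ^ 2 + 2 * (a ^ 2 * (f - f₀) ^ 2) := by
          nlinarith [sq_nonneg (x - a * f₀ + a * (f - f₀))]
        have h3 : ((x - a * f₀) ^ 2 / v + 1) * (2 * (v : ℝ)) = 2 * (x - a * f₀) ^ 2 + 2 * v := by
          field_simp
        rw [h3]
        linarith
    _ ≤ ∫ f, lik a v x f ∂μ :=
        setIntegral_le_integral (integrable_lik μ a v x)
          (.of_forall fun f => (lik_pos a v x f).le)

theorem neg_log_evid_le {f₀ : ℝ} {I : Set ℝ} (hI : MeasurableSet I)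
    (hIf : ∀ f ∈ I, a ^ 2 * (f - f₀) ^ 2 ≤ v) {Λ : ℝ} (hΛ : Real.exp (-Λ) ≤ μ.real I) (x : ℝ) :
    -Real.log (evid μ a v x) ≤ Λ + (x - a * f₀) ^ 2 / v + 1 := by
  have h1 : Real.exp (-(Λ + (x - a * f₀) ^ 2 / v + 1)) ≤ evid μ a v x := by
    refine le_trans ?_ (evid_ge_of_small_ball μ a hv hI hIf x)
    rw [show -(Λ + (x - a * f₀) ^ 2 / v + 1) = -Λ + -((x - a * f₀) ^ 2 / v + 1) by ring,
      Real.exp_add]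
    gcongr
  have := (Real.le_log_iff_exp_le (evid_pos μ a v x)).2 h1
  linarith

/-- Split `a (f - f₀)` through the observation `x`. The posterior mean of `(x - a f)²` is at most
`2v` times minus the log-evidence, which the small ball bounds. -/
theorem posterior_sq_le (ha : 0 < a) {f₀ : ℝ} {I : Set ℝ} (hI : MeasurableSet I)
    (hIf : ∀ f ∈ I, a ^ 2 * (f - f₀) ^ 2 ≤ v) {Λ : ℝ} (hΛ : Real.exp (-Λ) ≤ μ.real I) (x : ℝ) :
    ∫⁻ f, ENNReal.ofReal ((f - f₀) ^ 2) ∂(coordPosterior μ a v x)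
      ≤ ENNReal.ofReal (2 / a ^ 2 * (2 * v * (Λ + 1) + 3 * (x - a * f₀) ^ 2)) := by
  have hv' : (0 : ℝ) < v := by positivity
  have he := evid_pos μ a v x
  obtain ⟨hint, hG⟩ := integral_lik_mul_sq_le μ a hv x
  have hpt : ∀ f, lik a v x f / evid μ a v x * (f - f₀) ^ 2
      ≤ 2 / a ^ 2 * (evid μ a v x)⁻¹
        * (lik a v x f * (x - a * f) ^ 2 + lik a v x f * (x - a * f₀) ^ 2) := fun f => by
    have h1 : (f - f₀) ^ 2 ≤ 2 / a ^ 2 * ((x - a * f) ^ 2 + (x - a * f₀) ^ 2) := by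
      rw [div_mul_eq_mul_div, le_div_iff₀ (by positivity)]
      nlinarith [sq_nonneg ((x - a * f) + (x - a * f₀))]
    calc lik a v x f / evid μ a v x * (f - f₀) ^ 2
        ≤ lik a v x f / evid μ a v x * (2 / a ^ 2 * ((x - a * f) ^ 2 + (x - a * f₀) ^ 2)) :=
          mul_le_mul_of_nonneg_left h1 (div_nonneg (lik_pos a v x f).le he.le)
      _ = _ := by ring
  have hint2 : Integrable (fun f => 2 / a ^ 2 * (evid μ a v x)⁻¹
      * (lik a v x f * (x - a * f) ^ 2 + lik a v x f * (x - a * f₀) ^ 2)) μ :=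
    (hint.add ((integrable_lik μ a v x).mul_const _)).const_mul _
  rw [lintegral_coordPosterior μ a v x (by fun_prop)]
  refine (lintegral_mono fun f => ENNReal.ofReal_le_ofReal (hpt f)).trans ?_
  rw [← ofReal_integral_eq_lintegral_ofReal hint2 (.of_forall fun f => by
    have := (lik_pos a v x f).le
    positivity)]
  refine ENNReal.ofReal_le_ofReal ?_
  rw [integral_const_mul, integral_add hint ((integrable_lik μ a v x).mul_const _),
    integral_mul_const, ← evid, mul_assoc]
  refine mul_le_mul_of_nonneg_left ?_ (by positivity)
  have hL := neg_log_evid_le μ a hv hI hIf hΛ x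
  rw [inv_mul_le_iff₀ he]
  have h3 : 2 * (v : ℝ) * -Real.log (evid μ a v x)
      ≤ 2 * v * (Λ + 1) + 2 * (x - a * f₀) ^ 2 := by
    calc 2 * (v : ℝ) * -Real.log (evid μ a v x) ≤ 2 * v * (Λ + (x - a * f₀) ^ 2 / v + 1) := by
          gcongr
      _ = _ := by field_simp; ring
  nlinarith [mul_le_mul_of_nonneg_left h3 he.le]

/-- A Gaussian-integrable function dominating polynomials in the standardized variable. -/
theorem lintegral_exp_envelope (m : ℝ) :
    ∫⁻ x, ENNReal.ofReal (Real.exp ((x - m) / √v) + Real.exp (-((x - m) / √v)))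
      ∂(gaussianReal m v) ≤ 4 := by
  have hv' : (0 : ℝ) < v := by positivity
  have hs : (√v : ℝ) ^ 2 = v := Real.sq_sqrt hv'.le
  have hs0 : 0 < √(v : ℝ) := Real.sqrt_pos.2 hv'
  have key : ∀ t : ℝ, t ^ 2 * v = 1 →
      ∫⁻ x, ENNReal.ofReal (Real.exp (t * (x - m))) ∂(gaussianReal m v) ≤ 2 := by
    intro t ht
    have hfun : (fun x => Real.exp (t * (x - m)))
        = fun x => Real.exp (-(t * m)) * Real.exp (t * x) := by
      ext x; rw [← Real.exp_add]; ring_nf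
    have hi := integrable_exp_mul_gaussianReal (μ := m) (v := v) t
    rw [← ofReal_integral_eq_lintegral_ofReal (hfun ▸ hi.const_mul _)
      (.of_forall fun x => (Real.exp_pos _).le), hfun, integral_const_mul]
    have hmgf : ∫ x, Real.exp (t * x) ∂(gaussianReal m v) = Real.exp (m * t + v * t ^ 2 / 2) :=
      congrFun (mgf_fun_id_gaussianReal (μ := m) (v := v)) t
    rw [hmgf, ← Real.exp_add]
    have : Real.exp (-(t * m) + (m * t + v * t ^ 2 / 2)) ≤ 2 := by
      rw [show -(t * m) + (m * t + v * t ^ 2 / 2) = (t ^ 2 * v) / 2 by ring, ht,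
        ← Real.le_log_iff_exp_le (by norm_num)]
      linarith [Real.log_two_gt_d9]
    calc ENNReal.ofReal _ ≤ ENNReal.ofReal 2 := ENNReal.ofReal_le_ofReal this
      _ = 2 := by simp
  have hm : ∀ t : ℝ, Measurable fun x => ENNReal.ofReal (Real.exp (t * (x - m))) := by
    intro t; fun_prop
  calc ∫⁻ x, ENNReal.ofReal (Real.exp ((x - m) / √v) + Real.exp (-((x - m) / √v)))
      ∂(gaussianReal m v)
      = ∫⁻ x, (ENNReal.ofReal (Real.exp ((√v)⁻¹ * (x - m)))
          + ENNReal.ofReal (Real.exp (-(√v)⁻¹ * (x - m)))) ∂(gaussianReal m v) := by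
        refine lintegral_congr fun x => ?_
        rw [ENNReal.ofReal_add (Real.exp_pos _).le (Real.exp_pos _).le]
        congr 3 <;> ring
    _ ≤ 2 + 2 := by
        rw [lintegral_add_left (hm _)]
        have h1 : ((√v : ℝ)⁻¹) ^ 2 * v = 1 := by rw [inv_pow, hs]; field_simp
        exact add_le_add (key _ h1) (key _ (by rw [neg_sq, h1]))
    _ = 4 := by norm_num

omit hv in
-- One exponential envelope dominates every polynomial used below, so the Gaussian moment generating
-- function replaces separate moment computations.
theorem envelope_bounds (t : ℝ) :
    2 ≤ Real.exp t + Real.exp (-t) ∧ t ^ 2 ≤ 2 * (Real.exp t + Real.exp (-t)) ∧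
      t ^ 4 ≤ 24 * (Real.exp t + Real.exp (-t)) := by
  have h2 := Real.pow_div_factorial_le_exp |t| (abs_nonneg t) 2
  have h4 := Real.pow_div_factorial_le_exp |t| (abs_nonneg t) 4
  have hle : Real.exp |t| ≤ Real.exp t + Real.exp (-t) := by
    rcases abs_cases t with ⟨h, _⟩ | ⟨h, _⟩ <;> rw [h] <;>
      linarith [Real.exp_pos t, Real.exp_pos (-t)]
  rw [sq_abs] at h2
  rw [show |t| ^ 4 = t ^ 4 from (Even.pow_abs ⟨2, rfl⟩ t)] at h4
  norm_num [Nat.factorial] at h2 h4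
  refine ⟨?_, by linarith, by linarith⟩
  linarith [Real.add_one_le_exp t, Real.add_one_le_exp (-t)]

omit hv in
/-- The expected squared error of a draw from the coordinate posterior. -/
noncomputable def coordRisk (v : ℝ≥0) (f₀ : ℝ) : ℝ≥0∞ :=
  ∫⁻ x, ∫⁻ f, ENNReal.ofReal ((f - f₀) ^ 2) ∂(coordPosterior μ a v x) ∂(gaussianReal (a * f₀) v)

theorem lintegral_gaussian_le_of_envelope (m : ℝ) {F : ℝ → ℝ≥0∞} {c : ℝ} (hc : 0 ≤ c)
    (hF : ∀ x, F x ≤ ENNReal.ofReal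
      (c * (Real.exp ((x - m) / √v) + Real.exp (-((x - m) / √v))))) :
    ∫⁻ x, F x ∂(gaussianReal m v) ≤ ENNReal.ofReal (4 * c) := by
  calc ∫⁻ x, F x ∂(gaussianReal m v)
      ≤ ∫⁻ x, ENNReal.ofReal c * ENNReal.ofReal
          (Real.exp ((x - m) / √v) + Real.exp (-((x - m) / √v))) ∂(gaussianReal m v) :=
        lintegral_mono fun x => (hF x).trans_eq (ENNReal.ofReal_mul hc)
    _ ≤ ENNReal.ofReal c * 4 := by
        rw [lintegral_const_mul _ (by fun_prop)]
        gcongr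
        exact lintegral_exp_envelope hv m
    _ = ENNReal.ofReal (4 * c) := by
        rw [mul_comm 4 c, ENNReal.ofReal_mul hc]; norm_num

theorem coordRisk_le_parametric (ha : 0 < a) {f₀ : ℝ} {I : Set ℝ} (hI : MeasurableSet I)
    (hIf : ∀ f ∈ I, a ^ 2 * (f - f₀) ^ 2 ≤ v) {Λ : ℝ} (hΛ0 : 0 ≤ Λ)
    (hΛ : Real.exp (-Λ) ≤ μ.real I) :
    coordRisk μ a v f₀ ≤ ENNReal.ofReal (v / a ^ 2 * (8 * Λ + 56)) := by
  have hv' : (0 : ℝ) < v := by positivity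
  have hs : (√v : ℝ) ^ 2 = v := Real.sq_sqrt hv'.le
  have h := lintegral_gaussian_le_of_envelope hv (a * f₀) (c := v / a ^ 2 * (2 * Λ + 14))
    (F := fun x => ∫⁻ f, ENNReal.ofReal ((f - f₀) ^ 2) ∂(coordPosterior μ a v x))
    (by positivity) (fun x => ?_)
  · exact h.trans_eq (by ring_nf)
  refine (posterior_sq_le μ a hv ha hI hIf hΛ x).trans (ENNReal.ofReal_le_ofReal ?_)
  obtain ⟨h1, h2, -⟩ := envelope_bounds ((x - a * f₀) / √v)
  rw [div_pow, hs, div_le_iff₀ hv'] at h2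
  set G := Real.exp ((x - a * f₀) / √v) + Real.exp (-((x - a * f₀) / √v))
  have h3 : 2 * (v : ℝ) * (Λ + 1) + 3 * (x - a * f₀) ^ 2 ≤ v * (Λ + 7) * G := by
    have : (v : ℝ) * (Λ + 1) * 2 ≤ v * (Λ + 1) * G := by gcongr
    linarith
  calc 2 / a ^ 2 * (2 * v * (Λ + 1) + 3 * (x - a * f₀) ^ 2) ≤ 2 / a ^ 2 * (v * (Λ + 7) * G) := by
        gcongr
    _ = _ := by ring

variable (hμ2 : Integrable (fun f => f ^ 2) μ) (hμ0 : ∫ f, f ∂μ = 0)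

include hμ2 hμ0

/-- Jensen for `exp`: the prior has mean zero, so the cross term in `x` and `f` disappears from the
averaged exponent. -/
theorem evid_ge_of_centered (x : ℝ) :
    Real.exp (-(x ^ 2 + a ^ 2 * ∫ f, f ^ 2 ∂μ) / (2 * v)) ≤ evid μ a v x := by
  have hμ1 : Integrable (fun f : ℝ => f) μ := by
    refine ((integrable_const (1 : ℝ)).add hμ2).mono' measurable_id.aestronglyMeasurable
      (.of_forall fun f => ?_)
    rw [Real.norm_eq_abs, Pi.add_apply, ← sq_abs]
    nlinarith [sq_nonneg (|f| - 1), abs_nonneg f]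
  have hfun : (fun f => -(x - a * f) ^ 2 / (2 * (v : ℝ)))
      = fun f => -x ^ 2 / (2 * v) + (a * x / v) * f - a ^ 2 / (2 * v) * f ^ 2 := by
    ext f; field_simp; ring
  have hi1 : Integrable (fun f => -x ^ 2 / (2 * (v : ℝ)) + (a * x / v) * f) μ :=
    (integrable_const _).add (hμ1.const_mul _)
  have hi : Integrable (fun f => -(x - a * f) ^ 2 / (2 * (v : ℝ))) μ :=
    hfun ▸ hi1.sub (hμ2.const_mul _)
  have hJ := convexOn_exp.map_integral_le Real.continuous_exp.continuousOn isClosed_univ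
    (.of_forall fun _ => Set.mem_univ _) hi (integrable_lik μ a v x)
  refine le_trans (le_of_eq ?_) hJ
  rw [hfun, integral_sub hi1 (hμ2.const_mul _), integral_add (integrable_const _)
    (hμ1.const_mul _), integral_const_mul, integral_const_mul, hμ0]
  simp only [integral_const, probReal_univ, smul_eq_mul]
  congr 1
  field_simp
  ring

/-- Up to a factor depending on the prior variance relative to the noise, the predictive law may be
replaced by `N(0, v)`: the second exponential is the density of `N(a f₀, v)` against it. -/
theorem lik_div_evid_le (f₀ x : ℝ) : lik a v x f₀ / evid μ a v x
    ≤ Real.exp (a ^ 2 * (∫ f, f ^ 2 ∂μ) / (2 * v)) * Real.exp (x * (a * f₀) / v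
        - (a * f₀) ^ 2 / (2 * v)) := by
  have h := evid_ge_of_centered μ a hv hμ2 hμ0 x
  rw [div_le_iff₀ (evid_pos μ a v x)]
  calc lik a v x f₀ = Real.exp (a ^ 2 * (∫ f, f ^ 2 ∂μ) / (2 * v)) * Real.exp (x * (a * f₀) / v
        - (a * f₀) ^ 2 / (2 * v)) * Real.exp (-(x ^ 2 + a ^ 2 * ∫ f, f ^ 2 ∂μ) / (2 * v)) := by
        rw [lik, ← Real.exp_add, ← Real.exp_add]
        congr 1
        field_simp
        ring
    _ ≤ _ := by gcongr

/-- The second moment of a density under the reference law is its mean under the law it defines,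
here a Gaussian exponential moment. -/
theorem lintegral_density_sq_le (f₀ : ℝ) :
    ∫⁻ x, ENNReal.ofReal (lik a v x f₀ / evid μ a v x) ^ 2 ∂(gaussKernel a v ∘ₘ μ)
      ≤ ENNReal.ofReal (Real.exp (a ^ 2 * (∫ f, f ^ 2 ∂μ) / (2 * v) + (a * f₀) ^ 2 / v)) := by
  have hd : Measurable fun x => ENNReal.ofReal (lik a v x f₀ / evid μ a v x) :=
    (((measurable_uncurry_lik a v).comp measurable_prodMk_right).div
      (measurable_evid μ a v)).ennreal_ofReal
  have h1 : ∫⁻ x, ENNReal.ofReal (lik a v x f₀ / evid μ a v x) ^ 2 ∂(gaussKernel a v ∘ₘ μ)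
      = ∫⁻ x, ENNReal.ofReal (lik a v x f₀ / evid μ a v x) ∂(gaussianReal (a * f₀) v) := by
    rw [gaussianReal_eq_withDensity_predictive μ a hv, lintegral_withDensity_eq_lintegral_mul _
      hd hd]
    simp [sq]
  set b := a * f₀
  have hi := (integrable_exp_mul_gaussianReal (μ := b) (v := v) (b / v)).const_mul
    (Real.exp (a ^ 2 * (∫ f, f ^ 2 ∂μ) / (2 * v) - b ^ 2 / (2 * v)))
  have hmgf : ∫ x, Real.exp (b / v * x) ∂(gaussianReal b v)
      = Real.exp (b * (b / v) + v * (b / v) ^ 2 / 2) :=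
    congrFun (mgf_fun_id_gaussianReal (μ := b) (v := v)) (b / v)
  rw [h1]
  calc ∫⁻ x, ENNReal.ofReal (lik a v x f₀ / evid μ a v x) ∂(gaussianReal b v)
      ≤ ∫⁻ x, ENNReal.ofReal (Real.exp (a ^ 2 * (∫ f, f ^ 2 ∂μ) / (2 * v) - b ^ 2 / (2 * v))
          * Real.exp (b / v * x)) ∂(gaussianReal b v) := by
        refine lintegral_mono fun x => ENNReal.ofReal_le_ofReal
          ((lik_div_evid_le μ a hv hμ2 hμ0 f₀ x).trans (le_of_eq ?_))
        rw [← Real.exp_add, ← Real.exp_add]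
        congr 1
        ring
    _ = _ := by
        rw [← ofReal_integral_eq_lintegral_ofReal hi (.of_forall fun x => by positivity),
          integral_const_mul, hmgf, ← Real.exp_add]
        congr 2
        field_simp
        ring

/-- When the signal is below the noise level, the coordinate risk is of the order of the prior
variance plus the squared signal, up to the small-ball exponent `Λ`. -/
theorem coordRisk_le_of_small_signal (ha : 0 < a) {f₀ : ℝ} (hf₀ : (a * f₀) ^ 2 ≤ v) {I : Set ℝ}
    (hI : MeasurableSet I) (hIf : ∀ f ∈ I, a ^ 2 * (f - f₀) ^ 2 ≤ v) {Λ : ℝ} (hΛ0 : 0 ≤ Λ)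
    (hΛ : Real.exp (-Λ) ≤ μ.real I) :
    coordRisk μ a v f₀ ≤ ENNReal.ofReal
      (2 * Real.exp (a ^ 2 * (∫ f, f ^ 2 ∂μ) / (2 * v) + 1) * (∫ f, f ^ 2 ∂μ)
        + f₀ ^ 2 * (80 * Λ + 1330)) := by
  have hv' : (0 : ℝ) < v := by positivity
  have hs : (√v : ℝ) ^ 2 = v := Real.sq_sqrt hv'.le
  set s₂ := ∫ f, f ^ 2 ∂μ with hs₂
  have hs₂0 : 0 ≤ s₂ := integral_nonneg fun f => sq_nonneg f
  set b := a * f₀ with hb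
  -- On this event the likelihood ratio against the predictive law is bounded; off it, `(x b)² / v²
  -- > 1` is a factor that can be inserted for free.
  let good : Set ℝ := {x | |x * b| ≤ v}
  have hgood : MeasurableSet good := measurableSet_le (by fun_prop) measurable_const
  have hd : Measurable fun x => ENNReal.ofReal (lik a v x f₀ / evid μ a v x) :=
    (((measurable_uncurry_lik a v).comp measurable_prodMk_right).div
      (measurable_evid μ a v)).ennreal_ofReal
  set J : ℝ → ℝ≥0∞ := fun x => ∫⁻ f, ENNReal.ofReal (f ^ 2) ∂(coordPosterior μ a v x) with hJ
  have hJm : Measurable J := Measurable.lintegral_kernel (by fun_prop)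
  have hgoodJ : ∫⁻ x in good, J x ∂(gaussianReal b v)
      ≤ ENNReal.ofReal (Real.exp (a ^ 2 * s₂ / (2 * v) + 1) * s₂) := by
    rw [gaussianReal_eq_withDensity_predictive μ a hv,
      setLIntegral_withDensity_eq_setLIntegral_mul _ hd hJm hgood]
    calc ∫⁻ x in good, ((fun x => ENNReal.ofReal (lik a v x f₀ / evid μ a v x)) * J) x
          ∂(gaussKernel a v ∘ₘ μ)
        ≤ ∫⁻ x in good, ENNReal.ofReal (Real.exp (a ^ 2 * s₂ / (2 * v) + 1)) * J x
          ∂(gaussKernel a v ∘ₘ μ) := by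
          refine setLIntegral_mono (hJm.const_mul _) fun x hx => ?_
          rw [Pi.mul_apply]
          gcongr
          refine (lik_div_evid_le μ a hv hμ2 hμ0 f₀ x).trans ?_
          rw [← Real.exp_add, Real.exp_le_exp]
          have h1 : x * b / v ≤ 1 := by
            rw [div_le_one hv']
            exact (le_abs_self _).trans hx
          have h2 : 0 ≤ b ^ 2 / (2 * (v : ℝ)) := by positivity
          linarith
      _ ≤ ∫⁻ x, ENNReal.ofReal (Real.exp (a ^ 2 * s₂ / (2 * v) + 1)) * J x
          ∂(gaussKernel a v ∘ₘ μ) := setLIntegral_le_lintegral _ _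
      -- Averaging the posterior over the predictive law returns the prior.
      _ = ENNReal.ofReal (Real.exp (a ^ 2 * s₂ / (2 * v) + 1)) * ENNReal.ofReal s₂ := by
          rw [lintegral_const_mul _ hJm, hJ, ← Measure.lintegral_bind (Kernel.aemeasurable _)
            (by fun_prop), comp_coordPosterior μ a hv,
            ofReal_integral_eq_lintegral_ofReal hμ2 (.of_forall fun f => sq_nonneg f)]
      _ = _ := by rw [ENNReal.ofReal_mul (Real.exp_pos _).le]
  have hG : ∀ x, x ∈ good → ∫⁻ f, ENNReal.ofReal ((f - f₀) ^ 2) ∂(coordPosterior μ a v x)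
      ≤ 2 * J x + ENNReal.ofReal (2 * f₀ ^ 2) := fun x _ => by
    calc ∫⁻ f, ENNReal.ofReal ((f - f₀) ^ 2) ∂(coordPosterior μ a v x)
        ≤ ∫⁻ f, (2 * ENNReal.ofReal (f ^ 2) + ENNReal.ofReal (2 * f₀ ^ 2))
            ∂(coordPosterior μ a v x) := by
          refine lintegral_mono fun f => ?_
          rw [show (2 : ℝ≥0∞) = ENNReal.ofReal 2 by simp, ← ENNReal.ofReal_mul (by norm_num),
            ← ENNReal.ofReal_add (by positivity) (by positivity)]
          exact ENNReal.ofReal_le_ofReal (by nlinarith [sq_nonneg (f + f₀)])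
      _ = _ := by
          rw [lintegral_add_right _ measurable_const, lintegral_const_mul _ (by fun_prop)]
          simp [hJ]
  have hbad : ∫⁻ x in goodᶜ, ∫⁻ f, ENNReal.ofReal ((f - f₀) ^ 2) ∂(coordPosterior μ a v x)
      ∂(gaussianReal b v) ≤ ENNReal.ofReal (f₀ ^ 2 * (80 * Λ + 1328)) := by
    rw [← lintegral_indicator hgood.compl]
    have h := lintegral_gaussian_le_of_envelope hv b (c := f₀ ^ 2 * (20 * Λ + 332))
      (F := (goodᶜ).indicator fun x =>
        ∫⁻ f, ENNReal.ofReal ((f - f₀) ^ 2) ∂(coordPosterior μ a v x))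
      (by positivity) (fun x => ?_)
    · exact h.trans_eq (by ring_nf)
    by_cases hx : x ∈ good
    · rw [Set.indicator_of_notMem (by simpa using hx)]
      exact zero_le
    rw [Set.indicator_of_mem (by simpa using hx)]
    refine (posterior_sq_le μ a hv ha hI hIf hΛ x).trans (ENNReal.ofReal_le_ofReal ?_)
    rw [← hb]
    have hx1 : (v : ℝ) ^ 2 ≤ (x * b) ^ 2 := by
      rw [← sq_abs (x * b)]
      have : (v : ℝ) < |x * b| := not_le.1 hx
      gcongr
    obtain ⟨h1, h2, h4⟩ := envelope_bounds ((x - b) / √v)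
    rw [div_pow, hs, div_le_iff₀ hv'] at h2
    rw [div_pow, show (√v : ℝ) ^ 4 = v ^ 2 by linear_combination ((√v : ℝ) ^ 2 + v) * hs,
      div_le_iff₀ (by positivity)] at h4
    set G := Real.exp ((x - b) / √v) + Real.exp (-((x - b) / √v))
    set y := x - b with hy
    have hyx : x ^ 2 ≤ 2 * y ^ 2 + 2 * v := by
      nlinarith [sq_nonneg (y - b), show x = y + b by rw [hy]; ring]
    -- Expanding with `x² ≤ 2y² + 2v`, the four products contribute `8(Λ + 1)`, `144`, `2(Λ + 1)`
    -- and `12` times `v² G`.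
    have hD : x ^ 2 * (2 * v * (Λ + 1) + 3 * y ^ 2) ≤ v ^ 2 * G * (10 * Λ + 166) := by
      have e1 : x ^ 2 * (2 * v * (Λ + 1) + 3 * y ^ 2)
          ≤ (2 * y ^ 2 + 2 * v) * (2 * v * (Λ + 1) + 3 * y ^ 2) := by gcongr
      have e2 : y ^ 2 * (v * (Λ + 1)) ≤ (2 * G * v) * (v * (Λ + 1)) := by gcongr
      have e3 : (v : ℝ) ^ 2 * (Λ + 1) * 2 ≤ v ^ 2 * (Λ + 1) * G := by gcongr
      have e4 : y ^ 2 * (v : ℝ) ≤ 2 * G * v * v := by gcongr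
      nlinarith
    have hv2 : (0 : ℝ) < v ^ 2 := by positivity
    -- The inserted factor contains `b² = a² f₀²`, which turns `1 / a²` into `f₀²`.
    calc 2 / a ^ 2 * (2 * v * (Λ + 1) + 3 * y ^ 2)
        ≤ 2 / a ^ 2 * ((x * b) ^ 2 / v ^ 2 * (2 * v * (Λ + 1) + 3 * y ^ 2)) := by
          gcongr
          exact le_mul_of_one_le_left (by positivity) ((one_le_div hv2).2 hx1)
      _ = 2 * f₀ ^ 2 / v ^ 2 * (x ^ 2 * (2 * v * (Λ + 1) + 3 * y ^ 2)) := by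
          rw [hb]; field_simp
      _ ≤ 2 * f₀ ^ 2 / v ^ 2 * (v ^ 2 * G * (10 * Λ + 166)) := by gcongr
      _ = _ := by field_simp; ring
  rw [coordRisk, ← lintegral_add_compl _ hgood]
  calc _ ≤ (2 * ENNReal.ofReal (Real.exp (a ^ 2 * s₂ / (2 * v) + 1) * s₂)
        + ENNReal.ofReal (2 * f₀ ^ 2)) + ENNReal.ofReal (f₀ ^ 2 * (80 * Λ + 1328)) := by
        refine add_le_add ?_ hbad
        refine (setLIntegral_mono (by fun_prop) hG).trans ?_
        rw [lintegral_add_right _ measurable_const, lintegral_const_mul _ hJm]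
        gcongr
        rw [setLIntegral_const]
        exact mul_le_of_le_one_right zero_le prob_le_one
    _ = _ := by
        rw [show (2 : ℝ≥0∞) = ENNReal.ofReal 2 by simp, ← ENNReal.ofReal_mul (by norm_num),
          ← ENNReal.ofReal_add (by positivity) (by positivity),
          ← ENNReal.ofReal_add (by positivity) (by positivity)]
        ring_nf

/-- Above noise level `v / a² < f₀²`, so the parametric bound is already of the required form and
the restriction on the signal can be dropped. -/
theorem coordRisk_le_prior (ha : 0 < a) {f₀ : ℝ} {I : Set ℝ}
    (hI : MeasurableSet I) (hIf : ∀ f ∈ I, a ^ 2 * (f - f₀) ^ 2 ≤ v) {Λ : ℝ} (hΛ0 : 0 ≤ Λ)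
    (hΛ : Real.exp (-Λ) ≤ μ.real I) :
    coordRisk μ a v f₀ ≤ ENNReal.ofReal
      (2 * Real.exp (a ^ 2 * (∫ f, f ^ 2 ∂μ) / (2 * v) + 1) * (∫ f, f ^ 2 ∂μ)
        + f₀ ^ 2 * (80 * Λ + 1330)) := by
  rcases le_or_gt ((a * f₀) ^ 2) v with h | h
  · exact coordRisk_le_of_small_signal μ a hv hμ2 hμ0 ha h hI hIf hΛ0 hΛ
  refine (coordRisk_le_parametric μ a hv ha hI hIf hΛ0 hΛ).trans (ENNReal.ofReal_le_ofReal ?_)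
  have hs₂0 : 0 ≤ ∫ f, f ^ 2 ∂μ := integral_nonneg fun f => sq_nonneg f
  have h1 : v / a ^ 2 ≤ f₀ ^ 2 := by
    rw [div_le_iff₀ (by positivity)]
    linarith [mul_pow a f₀ 2]
  calc v / a ^ 2 * (8 * Λ + 56) ≤ f₀ ^ 2 * (80 * Λ + 1330) := by gcongr <;> linarith
    _ ≤ _ := le_add_of_nonneg_left (by positivity)

end CoordinateRisk

/-! ### From posterior mass to a sum of coordinate risks. -/

section Reduction

/-- The law of one coordinate under the series prior. -/
noncomputable def coordPrior (σ : ℕ → ℝ) (H : Measure ℝ) (k : ℕ) : Measure ℝ :=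
  H.map (fun z => σ k * z)

instance (σ : ℕ → ℝ) (H : Measure ℝ) [IsProbabilityMeasure H] (k : ℕ) :
    IsProbabilityMeasure (coordPrior σ H k) :=
  Measure.isProbabilityMeasure_map (by fun_prop)

theorem model_eq_piKernel (κ : ℕ → ℝ) (n : ℕ) :
    model κ n = piKernel fun k => gaussKernel (κ k) (n : ℝ≥0)⁻¹ := rfl

variable (κ σ : ℕ → ℝ) (H : Measure ℝ) [IsProbabilityMeasure H] {n : ℕ} (hn : n ≠ 0)

include hn

theorem obsLaw_absolutelyContinuous_predictive {f₀ : ℕ → ℝ}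
    (hμ2 : ∀ k, Integrable (fun f => f ^ 2) (coordPrior σ H k))
    (hμ0 : ∀ k, ∫ f, f ∂(coordPrior σ H k) = 0)
    (hprior : Summable fun k => κ k ^ 2 * ∫ f, f ^ 2 ∂(coordPrior σ H k))
    (hsignal : Summable fun k => (κ k * f₀ k) ^ 2) :
    obsLaw κ n f₀ ≪ Measure.infinitePi fun k =>
      gaussKernel (κ k) (n : ℝ≥0)⁻¹ ∘ₘ coordPrior σ H k := by
  have hv : (n : ℝ≥0)⁻¹ ≠ 0 := by simpa using hn
  set v : ℝ≥0 := (n : ℝ≥0)⁻¹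
  set e : ℕ → ℝ := fun k => κ k ^ 2 * (∫ f, f ^ 2 ∂(coordPrior σ H k)) / (2 * v)
    + (κ k * f₀ k) ^ 2 / v with he
  have hes : Summable e := (hprior.div_const _).add (hsignal.div_const _)
  have he0 : ∀ k, 0 ≤ e k := fun k => by
    have : 0 ≤ ∫ f, f ^ 2 ∂(coordPrior σ H k) := integral_nonneg fun f => sq_nonneg f
    positivity
  refine infinitePi_absolutelyContinuous (fun k => gaussianReal (κ k * f₀ k) v) _
    (r := fun k x => ENNReal.ofReal (lik (κ k) v x (f₀ k) / evid (coordPrior σ H k) (κ k) v x))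
    (fun k => (((measurable_uncurry_lik (κ k) v).comp measurable_prodMk_right).div
      (measurable_evid _ (κ k) v)).ennreal_ofReal)
    (fun k => gaussianReal_eq_withDensity_predictive _ (κ k) hv (f₀ k))
    (ENNReal.ofReal (Real.exp (∑' k, e k))) ENNReal.ofReal_ne_top fun s => ?_
  calc _ ≤ ∏ k ∈ s, ENNReal.ofReal (Real.exp (e k)) :=
        Finset.prod_le_prod' fun k _ =>
          lintegral_density_sq_le _ (κ k) hv (hμ2 k) (hμ0 k) (f₀ k)
    _ = ENNReal.ofReal (Real.exp (∑ k ∈ s, e k)) := by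
        rw [Real.exp_sum, ENNReal.ofReal_prod_of_nonneg fun k _ => (Real.exp_pos _).le]
    _ ≤ _ := ENNReal.ofReal_le_ofReal (Real.exp_le_exp.2 (hes.sum_le_tsum s fun k _ => he0 k))

/-- Markov's inequality for the posterior: the expected posterior mass outside a ball is
controlled by the sum of the coordinate risks. -/
theorem lintegral_posterior_le_tsum_coordRisk {f₀ : ℕ → ℝ}
    (hμ2 : ∀ k, Integrable (fun f => f ^ 2) (coordPrior σ H k))
    (hμ0 : ∀ k, ∫ f, f ∂(coordPrior σ H k) = 0)
    (hprior : Summable fun k => κ k ^ 2 * ∫ f, f ^ 2 ∂(coordPrior σ H k))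
    (hsignal : Summable fun k => (κ k * f₀ k) ^ 2) {ε : ℝ} (hε : 0 < ε) :
    ∫⁻ X, posterior (model κ n) (prior σ H) X {f | ENNReal.ofReal ε < l2Dist f f₀}
        ∂(model κ n f₀)
      ≤ (∑' k, coordRisk (coordPrior σ H k) (κ k) (n : ℝ≥0)⁻¹ (f₀ k))
          / ENNReal.ofReal (ε ^ 2) := by
  have hv : (n : ℝ≥0)⁻¹ ≠ 0 := by simpa using hn
  set v : ℝ≥0 := (n : ℝ≥0)⁻¹
  set q : ℕ → Kernel ℝ ℝ := fun k => coordPosterior (coordPrior σ H k) (κ k) v with hq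
  have hqm : ∀ k, IsMarkovKernel (q k) := fun k => by rw [hq]; infer_instance
  -- The identification holds almost surely under the predictive law; absolute continuity transfers
  -- it to the law under `f₀`.
  have hpost : piKernel q =ᵐ[model κ n f₀] posterior (model κ n) (prior σ H) :=
    (obsLaw_absolutelyContinuous_predictive κ σ H hn hμ2 hμ0 hprior hsignal).ae_le
      (piKernel_ae_eq_posterior (coordPrior σ H) (fun k => gaussKernel (κ k) v) q
        fun k => compProd_coordPosterior _ (κ k) hv)
  have hm : ∀ k, Measurable fun f : ℕ → ℝ => ENNReal.ofReal ((f k - f₀ k) ^ 2) := fun k => by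
    fun_prop
  have hX : ∀ X, piKernel q X {f | ENNReal.ofReal ε < l2Dist f f₀}
      ≤ (∑' k, ∫⁻ f, ENNReal.ofReal ((f - f₀ k) ^ 2) ∂(q k (X k))) / ENNReal.ofReal (ε ^ 2) := by
    intro X
    calc piKernel q X {f | ENNReal.ofReal ε < l2Dist f f₀}
        ≤ piKernel q X {f | ENNReal.ofReal (ε ^ 2)
            ≤ ∑' k, ENNReal.ofReal ((f k - f₀ k) ^ 2)} := by
          refine measure_mono fun f hf => ?_
          rw [Set.mem_ofPred_eq, l2Dist] at hf
          have h := ENNReal.pow_le_pow_left (n := 2) hf.le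
          rw [← ENNReal.rpow_natCast (_ ^ (1 / 2 : ℝ)), ← ENNReal.rpow_mul,
            ← ENNReal.ofReal_pow hε.le] at h
          norm_num at h
          exact h
      _ ≤ (∫⁻ f, ∑' k, ENNReal.ofReal ((f k - f₀ k) ^ 2) ∂(piKernel q X))
            / ENNReal.ofReal (ε ^ 2) :=
          meas_ge_le_lintegral_div (Measurable.tsum hm).aemeasurable
            (by simpa using hε.ne') ENNReal.ofReal_ne_top
      _ = _ := by
          rw [lintegral_tsum fun k => (hm k).aemeasurable]
          congr 2 with k
          have : q k (X k) = (piKernel q X).map (fun f => f k) := by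
            rw [piKernel_apply, Measure.infinitePi_map_eval]
          rw [this, lintegral_map (by fun_prop) (by fun_prop)]
  have hcoord : ∀ k, Measurable fun x =>
      ∫⁻ f, ENNReal.ofReal ((f - f₀ k) ^ 2) ∂(q k x) := fun k =>
    Measurable.lintegral_kernel (by fun_prop)
  have hcoordX : ∀ k, Measurable fun X : ℕ → ℝ =>
      ∫⁻ f, ENNReal.ofReal ((f - f₀ k) ^ 2) ∂(q k (X k)) := fun k =>
    (hcoord k).comp (measurable_pi_apply k)
  calc ∫⁻ X, posterior (model κ n) (prior σ H) X {f | ENNReal.ofReal ε < l2Dist f f₀}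
        ∂(model κ n f₀)
      = ∫⁻ X, piKernel q X {f | ENNReal.ofReal ε < l2Dist f f₀} ∂(model κ n f₀) :=
        lintegral_congr_ae (by filter_upwards [hpost] with X h; rw [h])
    _ ≤ ∫⁻ X, (∑' k, ∫⁻ f, ENNReal.ofReal ((f - f₀ k) ^ 2) ∂(q k (X k)))
          / ENNReal.ofReal (ε ^ 2) ∂(model κ n f₀) := lintegral_mono hX
    _ = _ := by
        simp_rw [div_eq_mul_inv]
        rw [lintegral_mul_const _ (Measurable.tsum hcoordX),
          lintegral_tsum fun k => (hcoordX k).aemeasurable]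
        congr 2 with k
        have : gaussianReal (κ k * f₀ k) v = (model κ n f₀).map (fun X => X k) := by
          rw [model_eq_piKernel, piKernel_apply, Measure.infinitePi_map_eval, gaussKernel_apply]
        rw [coordRisk, this, lintegral_map (hcoord k) (by fun_prop)]

end Reduction

/-! ### Moments and small-ball mass of the heavy-tailed prior. -/

section HeavyTailedDensity

variable {H : Measure ℝ} {h : ℝ → ℝ} {c₁ ϱ : ℝ}

theorem IsHeavyTailed.apply_abs (hh : IsHeavyTailed h c₁ ϱ) (x : ℝ) : h |x| = h x := by
  rcases abs_cases x with ⟨hx, _⟩ | ⟨hx, _⟩ <;> rw [hx]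
  exact hh.symm x

theorem IsHeavyTailed.measurable (hh : IsHeavyTailed h c₁ ϱ) : Measurable h := by
  have hanti : Antitone fun x => h (max x 0) := fun x y hxy =>
    hh.antitoneOn (Set.mem_Ici.2 (le_max_right x 0)) (Set.mem_Ici.2 (le_max_right y 0))
      (max_le_max_right 0 hxy)
  have : h = (fun x => h (max x 0)) ∘ fun x => |x| := by
    ext x
    rw [Function.comp, max_eq_left (abs_nonneg x), hh.apply_abs]
  rw [this]
  exact hanti.measurable.comp (by fun_prop)

theorem integrable_sq_of_hasDensity (hH : HasDensity H h) (hh : IsHeavyTailed h c₁ ϱ)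
    (hmom : Integrable (fun x : ℝ => |x| ^ 2 * h x) volume) :
    Integrable (fun x => x ^ 2) H := by
  rw [hH, integrable_withDensity_iff hh.measurable.ennreal_ofReal (.of_forall fun x => by simp)]
  refine hmom.congr (.of_forall fun x => ?_)
  simp [ENNReal.toReal_ofReal (hh.pos x).le]

theorem integral_id_of_hasDensity (hH : HasDensity H h) (hh : IsHeavyTailed h c₁ ϱ) :
    ∫ x, x ∂H = 0 := by
  rw [hH, integral_withDensity_eq_integral_toReal_smul hh.measurable.ennreal_ofReal
    (.of_forall fun x => by simp)]
  have h1 : ∫ x, (ENNReal.ofReal (h x)).toReal • x = - ∫ x, (ENNReal.ofReal (h x)).toReal • x := by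
    rw [← integral_neg]
    conv_lhs => rw [← integral_neg_eq_self]
    congr 1 with x
    simp [hh.symm]
  linarith

theorem integrable_sq_coordPrior (hH : HasDensity H h) (hh : IsHeavyTailed h c₁ ϱ)
    (hmom : Integrable (fun x : ℝ => |x| ^ 2 * h x) volume) (σ : ℕ → ℝ) (k : ℕ) :
    Integrable (fun f => f ^ 2) (coordPrior σ H k) := by
  rw [coordPrior, integrable_map_measure (by fun_prop) (by fun_prop)]
  refine ((integrable_sq_of_hasDensity hH hh hmom).const_mul (σ k ^ 2)).congr
    (.of_forall fun x => ?_)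
  simp [mul_pow]

theorem integral_sq_coordPrior (σ : ℕ → ℝ) (k : ℕ) :
    ∫ f, f ^ 2 ∂(coordPrior σ H k) = σ k ^ 2 * ∫ x, x ^ 2 ∂H := by
  rw [coordPrior, integral_map (by fun_prop) (by fun_prop), ← integral_const_mul]
  simp only [mul_pow]

theorem integral_id_coordPrior (hH : HasDensity H h) (hh : IsHeavyTailed h c₁ ϱ) (σ : ℕ → ℝ)
    (k : ℕ) : ∫ f, f ∂(coordPrior σ H k) = 0 := by
  rw [coordPrior, integral_map (by fun_prop) (by fun_prop), integral_const_mul,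
    integral_id_of_hasDensity hH hh, mul_zero]

/-- Heavy tails make small balls around any bounded point have prior mass that is not
exponentially small in the inverse scale. -/
theorem exp_neg_le_coordPrior_ball [IsProbabilityMeasure H] (hH : HasDensity H h)
    (hh : IsHeavyTailed h c₁ ϱ) (hc₁ : 0 < c₁) (hϱ : 0 ≤ ϱ) {σ : ℕ → ℝ} {k : ℕ} (hσ : 0 < σ k)
    (hσ1 : σ k ≤ 1) {r L f₀ : ℝ} (hr : 0 < r) (hr1 : r ≤ 1) (hf₀ : |f₀| ≤ L) :
    Real.exp (-(-Real.log r
        + c₁ * (1 + (Real.log (L + 2) - Real.log (σ k)) ^ (1 + ϱ))))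
      ≤ (coordPrior σ H k).real {f | |f - f₀| ≤ r} := by
  set s := σ k
  have hL : 0 ≤ L := (abs_nonneg _).trans hf₀
  -- In the unscaled variable the ball is an interval of length `2r / s` on which `|z| ≤ y`, so `h
  -- y` bounds the density from below there.
  set y := (|f₀| + r) / s with hy
  have hy0 : 0 ≤ y := by positivity
  have hball : ENNReal.ofReal (2 * r / s * h y) ≤ coordPrior σ H k {f | |f - f₀| ≤ r} := by
    have hset : MeasurableSet {f : ℝ | |f - f₀| ≤ r} :=
      measurableSet_le (by fun_prop) measurable_const
    have hsub : Set.Icc ((f₀ - r) / s) ((f₀ + r) / s) ⊆ (fun z => s * z) ⁻¹' {f | |f - f₀| ≤ r} := by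
      intro z ⟨hz1, hz2⟩
      rw [div_le_iff₀ hσ] at hz1
      rw [le_div_iff₀ hσ] at hz2
      rw [Set.mem_preimage, Set.mem_ofPred_eq, abs_le]
      constructor <;> linarith
    rw [coordPrior, Measure.map_apply (by fun_prop) hset]
    refine le_trans ?_ (measure_mono hsub)
    rw [hH, withDensity_apply _ measurableSet_Icc]
    calc ENNReal.ofReal (2 * r / s * h y)
        = ∫⁻ _ in Set.Icc ((f₀ - r) / s) ((f₀ + r) / s), ENNReal.ofReal (h y) := by
          rw [setLIntegral_const, Real.volume_Icc, ← ENNReal.ofReal_mul (hh.pos y).le]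
          congr 1
          field_simp
          ring
      _ ≤ _ := by
          refine setLIntegral_mono hh.measurable.ennreal_ofReal fun z ⟨hz1, hz2⟩ =>
            ENNReal.ofReal_le_ofReal ?_
          rw [← hh.apply_abs z]
          refine hh.antitoneOn (abs_nonneg z) hy0 ?_
          rw [div_le_iff₀ hσ] at hz1
          rw [le_div_iff₀ hσ] at hz2
          rw [hy, le_div_iff₀ hσ, ← abs_of_pos hσ, ← abs_mul, abs_le]
          constructor <;> linarith [neg_abs_le f₀, le_abs_self f₀]
  have hreal : 2 * r / s * h y ≤ (coordPrior σ H k).real {f | |f - f₀| ≤ r} :=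
    (ENNReal.ofReal_le_iff_le_toReal (measure_ne_top _ _)).1 hball
  refine le_trans ?_ hreal
  have hpos : 0 < 2 * r / s * h y := mul_pos (by positivity) (hh.pos y)
  rw [← Real.le_log_iff_exp_le hpos, Real.log_mul (by positivity) (hh.pos y).ne']
  have h1 : Real.log r ≤ Real.log (2 * r / s) := by
    refine Real.log_le_log hr ?_
    rw [le_div_iff₀ hσ]
    nlinarith
  have h2 := hh.tail y hy0
  rw [one_div, Real.log_inv] at h2
  -- Since `s`, `r ≤ 1` and `|f₀| ≤ L`, `s (1 + y) = s + |f₀| + r ≤ L + 2`.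
  have h3 : Real.log (1 + y) ≤ Real.log (L + 2) - Real.log s := by
    rw [← Real.log_div (by positivity) hσ.ne']
    refine Real.log_le_log (by positivity) ?_
    rw [hy, le_div_iff₀ hσ, add_mul, div_mul_cancel₀ _ hσ.ne']
    linarith
  have h4 : Real.log (1 + y) ^ (1 + ϱ) ≤ (Real.log (L + 2) - Real.log s) ^ (1 + ϱ) :=
    Real.rpow_le_rpow (Real.log_nonneg (by linarith)) h3 (by linarith)
  have h5 := mul_le_mul_of_nonneg_left (add_le_add_right h4 1) hc₁.le
  linarith

end HeavyTailedDensity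

/-! ### Summation of the risk bounds around the cut-off. -/

section Sums

/-- A telescoping majorant for power tails. The ratio `x ^ (-b) / (x + 1) ^ (-b)` is at least `1 + b
/ (x + 1)`, and `x + 1 ≤ 2x` costs the factor `2 ^ (1 + b)`. -/
theorem rpow_neg_sub_rpow_neg_ge {b x : ℝ} (hb : 0 < b) (hx : 1 ≤ x) :
    x ^ (-1 - b) ≤ 2 ^ (1 + b) / b * (x ^ (-b) - (x + 1) ^ (-b)) := by
  have hx0 : 0 < x := by linarith
  have hx1 : 0 < x + 1 := by linarith
  have h1 : (x + 1) ^ (-b) * (1 + b * (x + 1)⁻¹) ≤ x ^ (-b) := by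
    have hlog : Real.log x - Real.log (x + 1) ≤ -(x + 1)⁻¹ := by
      rw [← Real.log_div hx0.ne' hx1.ne']
      refine (Real.log_le_sub_one_of_pos (by positivity)).trans (le_of_eq ?_)
      field_simp
      ring
    have h2 : 1 + b * (x + 1)⁻¹ ≤ Real.exp (b * (x + 1)⁻¹) := by
      linarith [Real.add_one_le_exp (b * (x + 1)⁻¹)]
    calc (x + 1) ^ (-b) * (1 + b * (x + 1)⁻¹) ≤ (x + 1) ^ (-b) * Real.exp (b * (x + 1)⁻¹) := by
          gcongr
      _ ≤ x ^ (-b) := by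
          rw [Real.rpow_def_of_pos hx1, Real.rpow_def_of_pos hx0, ← Real.exp_add, Real.exp_le_exp]
          nlinarith
  have h3 : x ^ (-1 - b) ≤ 2 ^ (1 + b) * (x + 1) ^ (-1 - b) := by
    have h4 : ((x + 1) / 2) ^ (-1 - b) = 2 ^ (1 + b) * (x + 1) ^ (-1 - b) := by
      rw [Real.div_rpow hx1.le (by norm_num), show (-1 - b) = -(1 + b) by ring,
        Real.rpow_neg (by norm_num : (0 : ℝ) ≤ 2), div_inv_eq_mul, mul_comm]
    rw [← h4]
    exact Real.rpow_le_rpow_of_nonpos (by linarith) (by linarith) (by linarith)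
  have h5 : (x + 1) ^ (-1 - b) = (x + 1) ^ (-b) * (x + 1)⁻¹ := by
    rw [← Real.rpow_neg_one, ← Real.rpow_add hx1]
    ring_nf
  refine h3.trans ?_
  rw [div_mul_eq_mul_div, le_div_iff₀ hb, mul_assoc]
  refine mul_le_mul_of_nonneg_left ?_ (by positivity)
  rw [h5]
  linarith

/-- Lets the Sobolev weight absorb the logarithm of `k` beyond the cut-off. It is `log u ≤ u ^ ε /
ε` with `ε = b / p`. -/
theorem one_add_log_rpow_le {b p u : ℝ} (hb : 0 < b) (hp : 0 < p) (hu : 1 ≤ u) :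
    (1 + Real.log u) ^ p ≤ (1 + p / b) ^ p * u ^ b := by
  have hu0 : 0 < u := by linarith
  have hε : 0 < b / p := by positivity
  have h1 : 1 + Real.log u ≤ (1 + p / b) * u ^ (b / p) := by
    have h2 := Real.log_le_rpow_div hu0.le hε
    have h3 : 1 ≤ u ^ (b / p) := Real.one_le_rpow hu hε.le
    rw [div_div_eq_mul_div, mul_comm, ← div_mul_eq_mul_div] at h2
    linarith
  calc (1 + Real.log u) ^ p ≤ ((1 + p / b) * u ^ (b / p)) ^ p :=
        Real.rpow_le_rpow (by linarith [Real.log_nonneg hu]) h1 hp.le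
    _ = _ := by
        rw [Real.mul_rpow (by positivity) (by positivity), ← Real.rpow_mul hu0.le,
          div_mul_cancel₀ _ hp.ne']

/-- Summation of coordinatewise bounds with a cut-off at `k ∼ n ^ (1 / (2β + 2ν + 1))`. -/
theorem exists_tsum_le_of_cutoff {β ν p A L : ℝ} (hβ : 0 < β) (hν : 0 ≤ ν) (hp : 0 < p)
    (hA : 0 ≤ A) :
    ∃ K : ℝ, 0 ≤ K ∧ ∀ n : ℕ, 3 ≤ n → ∀ (g : ℕ → ℝ) (R : ℕ → ℝ≥0∞), (∀ k, 0 ≤ g k) →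
      Summable (fun k : ℕ => ((k : ℝ) + 1) ^ (2 * β) * g k) →
      ∑' k : ℕ, ((k : ℝ) + 1) ^ (2 * β) * g k ≤ L ^ 2 →
      (∀ k : ℕ, R k ≤ ENNReal.ofReal
        (A * (1 + Real.log n + Real.log (k + 1)) ^ p * ((k : ℝ) + 1) ^ (2 * ν) / n)) →
      (∀ k : ℕ, (n : ℝ) ^ (1 / (2 * β + 2 * ν + 1)) < k + 1 → R k ≤ ENNReal.ofReal
        (A * ((k : ℝ) + 1) ^ (-1 - 2 * β)
          + A * (1 + Real.log n + Real.log (k + 1)) ^ p * g k)) →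
      ∑' k, R k ≤ ENNReal.ofReal
        (K * (Real.log n ^ p * (n : ℝ) ^ (-(2 * β) / (2 * β + 2 * ν + 1)))) := by
  set q := 2 * β + 2 * ν + 1 with hq
  have hq1 : 1 ≤ q := by linarith
  have hq0 : 0 < q := by linarith
  set C₂ : ℝ := 2 ^ (1 + 2 * β) / (2 * β) with hC₂
  have hC₂0 : 0 ≤ C₂ := by positivity
  set C₃ : ℝ := 3 ^ p * (1 + p / (2 * β)) ^ p with hC₃
  have hC₃0 : 0 ≤ C₃ := by positivity
  refine ⟨A * 3 ^ p + A * C₂ + A * C₃ * L ^ 2, by positivity, ?_⟩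
  intro n hn g R hg hgs hgL hR1 hR2
  have hn3 : (3 : ℝ) ≤ n := by exact_mod_cast hn
  have hn0 : (0 : ℝ) < n := by linarith
  set ℓ := Real.log n with hℓ
  have hℓ1 : 1 ≤ ℓ := by
    rw [hℓ, Real.le_log_iff_exp_le hn0]
    linarith [Real.exp_one_lt_d9]
  have hℓ0 : 0 < ℓ := by linarith
  set T : ℝ := (n : ℝ) ^ (1 / q) with hT
  have hT1 : 1 ≤ T := Real.one_le_rpow (by linarith) (by positivity)
  have hT0 : 0 < T := by linarith
  have hlogT : Real.log T ≤ ℓ := by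
    rw [hT, Real.log_rpow hn0, ← hℓ, one_div]
    exact mul_le_of_le_one_left hℓ0.le (inv_le_one_of_one_le₀ hq1)
  set a : ℝ := (n : ℝ) ^ (-(2 * β) / q) with ha
  have ha0 : 0 < a := Real.rpow_pos_of_pos hn0 _
  have hTa : T ^ (-(2 * β)) = a := by
    rw [hT, ha, ← Real.rpow_mul hn0.le]
    ring_nf
  -- The balance defining the cut-off: the variance of `T` coordinates equals the squared bias `T ^
  -- (-2β)`.
  have hTn : T * (T ^ (2 * ν) / n) = a := by
    have : (n : ℝ) = n ^ (1 : ℝ) := (Real.rpow_one _).symm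
    rw [hT, ha, ← Real.rpow_mul hn0.le]
    nth_rewrite 3 [this]
    rw [← Real.rpow_sub hn0, ← Real.rpow_add hn0]
    congr 1
    field_simp
    rw [hq]
    ring
  -- Truncation at `a` leaves the increments beyond `T` unchanged, while the telescoping sum over
  -- all `k` stays below `a`.
  set G : ℕ → ℝ := fun k => min (((k : ℝ) + 1) ^ (-(2 * β))) a with hG
  have hGanti : ∀ k, G (k + 1) ≤ G k := fun k =>
    min_le_min_right _ (Real.rpow_le_rpow_of_nonpos (by positivity)
      (by push_cast; linarith) (by linarith))
  set b₁ : ℕ → ℝ := fun k => if (k : ℝ) + 1 ≤ T then A * 3 ^ p * ℓ ^ p * (T ^ (2 * ν) / n) else 0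
  set b₂ : ℕ → ℝ := fun k => A * C₂ * (G k - G (k + 1))
  set b₃ : ℕ → ℝ := fun k => A * C₃ * ℓ ^ p * a * (((k : ℝ) + 1) ^ (2 * β) * g k)
  have hb₁ : ∀ k, 0 ≤ b₁ k := fun k => by
    simp only [b₁]; split_ifs <;> positivity
  have hb₂ : ∀ k, 0 ≤ b₂ k := fun k =>
    mul_nonneg (by positivity) (sub_nonneg.2 (hGanti k))
  have hb₃ : ∀ k, 0 ≤ b₃ k := fun k => by
    have := hg k
    positivity
  have hRb : ∀ k, R k ≤ ENNReal.ofReal (b₁ k + b₂ k + b₃ k) := by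
    intro k
    have hm1 : (1 : ℝ) ≤ (k : ℝ) + 1 := by linarith [Nat.cast_nonneg (α := ℝ) k]
    have hm0 : (0 : ℝ) < (k : ℝ) + 1 := by linarith
    have hlm := Real.log_nonneg hm1
    rcases le_or_gt ((k : ℝ) + 1) T with hkT | hkT
    · refine (hR1 k).trans (ENNReal.ofReal_le_ofReal ?_)
      have h1 : A * (1 + ℓ + Real.log (k + 1)) ^ p * ((k : ℝ) + 1) ^ (2 * ν) / n ≤ b₁ k := by
        simp only [b₁, if_pos hkT]
        rw [mul_div_assoc, mul_assoc A (3 ^ p), ← Real.mul_rpow (by norm_num) hℓ0.le]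
        have := Real.log_le_log hm0 hkT
        gcongr
        linarith
      linarith [hb₂ k, hb₃ k]
    · refine (hR2 k hkT).trans (ENNReal.ofReal_le_ofReal ?_)
      have h2 : A * ((k : ℝ) + 1) ^ (-1 - 2 * β) ≤ b₂ k := by
        have hGk : ∀ j : ℕ, T ≤ (j : ℝ) + 1 → G j = ((j : ℝ) + 1) ^ (-(2 * β)) := fun j hj =>
          min_eq_left (hTa ▸ Real.rpow_le_rpow_of_nonpos hT0 hj (by linarith))
        simp only [b₂]
        rw [hGk k hkT.le, hGk (k + 1) (by push_cast; linarith), mul_assoc]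
        push_cast
        exact mul_le_mul_of_nonneg_left (rpow_neg_sub_rpow_neg_ge (by positivity) hm1) hA
      have h3 : A * (1 + ℓ + Real.log (k + 1)) ^ p * g k ≤ b₃ k := by
        set u := ((k : ℝ) + 1) / T with hu
        have hu1 : 1 ≤ u := (one_le_div hT0).2 hkT.le
        have hlogu : Real.log (k + 1) = Real.log T + Real.log u := by
          rw [hu, Real.log_div hm0.ne' hT0.ne']; ring
        have hlu := Real.log_nonneg hu1
        -- Only the excess `u` over the cut-off needs absorbing, since `log T ≤ ℓ`; then `u ^ (2β)`
        -- is `a` times the Sobolev weight.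
        have h4 : (1 + ℓ + Real.log (k + 1)) ^ p ≤ C₃ * ℓ ^ p * a * ((k : ℝ) + 1) ^ (2 * β) := by
          calc (1 + ℓ + Real.log (k + 1)) ^ p ≤ (3 * ℓ * (1 + Real.log u)) ^ p := by
                refine Real.rpow_le_rpow (by linarith) ?_ hp.le
                nlinarith
            _ = 3 ^ p * ℓ ^ p * (1 + Real.log u) ^ p := by
                rw [Real.mul_rpow (by positivity) (by positivity),
                  Real.mul_rpow (by norm_num) hℓ0.le]
            _ ≤ 3 ^ p * ℓ ^ p * ((1 + p / (2 * β)) ^ p * u ^ (2 * β)) := by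
                gcongr
                exact one_add_log_rpow_le (by positivity) hp hu1
            _ = _ := by
                rw [hu, Real.div_rpow hm0.le hT0.le, ← hTa, Real.rpow_neg hT0.le, hC₃]
                ring
        calc A * (1 + ℓ + Real.log (k + 1)) ^ p * g k
            ≤ A * (C₃ * ℓ ^ p * a * ((k : ℝ) + 1) ^ (2 * β)) * g k := by
              have := hg k
              gcongr
          _ = _ := by simp only [b₃]; ring
      linarith [hb₁ k]
  have hsum₁ : ∀ N, ∑ k ∈ Finset.range N, b₁ k ≤ A * 3 ^ p * (ℓ ^ p * a) := by
    intro N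
    simp only [b₁]
    rw [← Finset.sum_filter, Finset.sum_const, nsmul_eq_mul]
    have hcard : (((Finset.range N).filter fun k : ℕ => (k : ℝ) + 1 ≤ T).card : ℝ) ≤ T := by
      have : ((Finset.range N).filter fun k : ℕ => (k : ℝ) + 1 ≤ T).card ≤ ⌊T⌋₊ := by
        rw [← Finset.card_range ⌊T⌋₊]
        refine Finset.card_le_card fun k hk => ?_
        rw [Finset.mem_range, ← Nat.succ_le_iff, Nat.le_floor_iff hT0.le]
        push_cast
        exact (Finset.mem_filter.1 hk).2
      exact (Nat.cast_le.2 this).trans (Nat.floor_le hT0.le)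
    calc _ ≤ T * (A * 3 ^ p * ℓ ^ p * (T ^ (2 * ν) / n)) := by gcongr
      _ = A * 3 ^ p * ℓ ^ p * (T * (T ^ (2 * ν) / n)) := by ring
      _ = _ := by rw [hTn]; ring
  have hsum₂ : ∀ N, ∑ k ∈ Finset.range N, b₂ k ≤ A * C₂ * a := by
    intro N
    simp only [b₂]
    rw [← Finset.mul_sum, Finset.sum_range_sub']
    refine mul_le_mul_of_nonneg_left ?_ (by positivity)
    have h1 : G 0 ≤ a := min_le_right _ _
    have h2 : 0 ≤ G N := le_min (by positivity) ha0.le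
    linarith
  have hsum₃ : ∀ N, ∑ k ∈ Finset.range N, b₃ k ≤ A * C₃ * ℓ ^ p * a * L ^ 2 := by
    intro N
    simp only [b₃]
    rw [← Finset.mul_sum]
    refine mul_le_mul_of_nonneg_left ?_ (by positivity)
    refine (hgs.sum_le_tsum _ fun k _ => ?_).trans hgL
    have := hg k
    positivity
  refine ENNReal.tsum_le_of_sum_range_le fun N => ?_
  calc ∑ k ∈ Finset.range N, R k ≤ ∑ k ∈ Finset.range N, ENNReal.ofReal (b₁ k + b₂ k + b₃ k) :=
        Finset.sum_le_sum fun k _ => hRb k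
    _ = ENNReal.ofReal (∑ k ∈ Finset.range N, (b₁ k + b₂ k + b₃ k)) :=
        (ENNReal.ofReal_sum_of_nonneg fun k _ =>
          add_nonneg (add_nonneg (hb₁ k) (hb₂ k)) (hb₃ k)).symm
    _ ≤ _ := by
        refine ENNReal.ofReal_le_ofReal ?_
        rw [Finset.sum_add_distrib, Finset.sum_add_distrib]
        have hp1 : 1 ≤ ℓ ^ p := Real.one_le_rpow hℓ1 hp.le
        have h4 : A * C₂ * a ≤ A * C₂ * (ℓ ^ p * a) := by
          gcongr
          exact le_mul_of_one_le_left ha0.le hp1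
        linarith [hsum₁ N, hsum₂ N, hsum₃ N]

end Sums

/-! ### Uniform risk bounds in the sequence model and posterior contraction. -/

section Contraction

theorem sq_le_of_mem_sobolevBall {β L : ℝ} (hβ : 0 < β) {f₀ : ℕ → ℝ} (hf : f₀ ∈ sobolevBall β L)
    (k : ℕ) : f₀ k ^ 2 ≤ L ^ 2 := by
  have h0 : ∀ j : ℕ, 0 ≤ ((j : ℝ) + 1) ^ (2 * β) * f₀ j ^ 2 := fun j => by positivity
  have h1 : (1 : ℝ) ≤ ((k : ℝ) + 1) ^ (2 * β) :=
    Real.one_le_rpow (by linarith [Nat.cast_nonneg (α := ℝ) k]) (by positivity)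
  calc f₀ k ^ 2 ≤ ((k : ℝ) + 1) ^ (2 * β) * f₀ k ^ 2 := le_mul_of_one_le_left (sq_nonneg _) h1
    _ ≤ _ := (hf.1.le_tsum k fun j _ => h0 j).trans hf.2

variable {ν : ℝ} {κ : ℕ → ℝ} {H : Measure ℝ} [IsProbabilityMeasure H] {h : ℝ → ℝ} {c₁ ϱ β L : ℝ}
  {σ : ℕ → ℝ} {B : ℝ}

/-- A polylogarithmic bound on the small-ball exponents of the prior. -/
theorem exists_smallBall_exponent (hH : HasDensity H h) (hc₁ : 0 < c₁) (hϱ : 0 ≤ ϱ)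
    (hh : IsHeavyTailed h c₁ ϱ) (hL : 0 < L) (hσ0 : ∀ k, 0 < σ k) (hσ1 : ∀ k, σ k ≤ 1)
    (hB : 0 ≤ B) (hσlog : ∀ k : ℕ, -Real.log (σ k) ≤ B * (1 + Real.log (k + 1)) ^ 2)
    {C : ℝ} (hC : 1 ≤ C) :
    ∃ A : ℝ, 0 ≤ A ∧ ∀ n : ℕ, 1 ≤ n → ∀ (k : ℕ) (f₀ : ℝ), |f₀| ≤ L →
      Real.exp (-(A * (1 + Real.log n + Real.log (k + 1)) ^ (2 * (1 + ϱ))))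
        ≤ (coordPrior σ H k).real {f | |f - f₀| ≤ 1 / (C * √n)} := by
  have hlogC := Real.log_nonneg hC
  have hlogL : 0 ≤ Real.log (L + 2) := Real.log_nonneg (by linarith)
  refine ⟨Real.log C + 1 + c₁ + c₁ * (Real.log (L + 2) + B) ^ (1 + ϱ), by positivity, ?_⟩
  intro n hn k f₀ hf₀
  have hn1 : (1 : ℝ) ≤ n := by exact_mod_cast hn
  have hsn : 1 ≤ √(n : ℝ) := Real.one_le_sqrt.2 hn1
  have hCn : 1 ≤ C * √n := by nlinarith
  refine le_trans ?_ (exp_neg_le_coordPrior_ball hH hh hc₁ hϱ (hσ0 k) (hσ1 k)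
    (r := 1 / (C * √n)) (by positivity) (by rw [div_le_one (by linarith)]; exact hCn) hf₀)
  rw [Real.exp_le_exp, neg_le_neg_iff]
  have hln := Real.log_nonneg hn1
  have hlk : 0 ≤ Real.log ((k : ℝ) + 1) :=
    Real.log_nonneg (by linarith [Nat.cast_nonneg (α := ℝ) k])
  set ℓ := 1 + Real.log n + Real.log (k + 1) with hℓ
  have hℓ1 : 1 ≤ ℓ := by linarith
  have hlogr : -Real.log (1 / (C * √n)) ≤ Real.log C + ℓ := by
    rw [one_div, Real.log_inv, neg_neg, Real.log_mul (by positivity) (by positivity),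
      Real.log_sqrt (by positivity)]
    linarith
  have hℓp : ℓ ≤ ℓ ^ (2 * (1 + ϱ)) := Real.self_le_rpow_of_one_le hℓ1 (by linarith)
  -- The exponent `2 (1 + ϱ)` combines the squared logarithm allowed in `log (1 / σ k)` with the
  -- tail exponent of `h`.
  have hpow : (Real.log (L + 2) - Real.log (σ k)) ^ (1 + ϱ)
      ≤ (Real.log (L + 2) + B) ^ (1 + ϱ) * ℓ ^ (2 * (1 + ϱ)) := by
    have h1 : Real.log (L + 2) - Real.log (σ k) ≤ (Real.log (L + 2) + B) * ℓ ^ (2 : ℝ) := by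
      have h2 : (1 + Real.log ((k : ℝ) + 1)) ^ 2 ≤ ℓ ^ 2 := by
        gcongr
        linarith
      have h3 : 1 ≤ ℓ ^ 2 := one_le_pow₀ hℓ1
      have h4 := hσlog k
      have h5 := mul_le_mul_of_nonneg_left h2 hB
      have h6 := mul_le_mul_of_nonneg_left h3 hlogL
      rw [Real.rpow_two]
      linarith
    have h0 : 0 ≤ Real.log (L + 2) - Real.log (σ k) := by
      linarith [Real.log_nonpos (hσ0 k).le (hσ1 k)]
    calc _ ≤ ((Real.log (L + 2) + B) * ℓ ^ (2 : ℝ)) ^ (1 + ϱ) :=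
          Real.rpow_le_rpow h0 h1 (by linarith)
      _ = _ := by
          rw [Real.mul_rpow (by positivity) (by positivity), ← Real.rpow_mul (by linarith)]
  have hp1 : 1 ≤ ℓ ^ (2 * (1 + ϱ)) := hℓ1.trans hℓp
  have e1 := mul_le_mul_of_nonneg_left hpow hc₁.le
  have e2 := mul_le_mul_of_nonneg_left hp1 hlogC
  have e3 := mul_le_mul_of_nonneg_left hp1 hc₁.le
  linarith

/-- Coordinatewise risk bounds in the sequence model, uniformly over bounded signals. -/
theorem exists_coordRisk_le (hν : 0 ≤ ν) (hκ : HasIllPosedness κ ν) (hH : HasDensity H h)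
    (hc₁ : 0 < c₁) (hϱ : 0 ≤ ϱ) (hh : IsHeavyTailed h c₁ ϱ)
    (hmom : Integrable (fun x : ℝ => |x| ^ 2 * h x) volume) (hβ : 0 < β) (hL : 0 < L)
    (hσ0 : ∀ k, 0 < σ k) (hσ1 : ∀ k, σ k ≤ 1)
    (hB : 0 ≤ B) (hσlog : ∀ k : ℕ, -Real.log (σ k) ≤ B * (1 + Real.log (k + 1)) ^ 2)
    (hσβ : ∀ k : ℕ, σ k ^ 2 ≤ B * ((k : ℝ) + 1) ^ (-1 - 2 * β)) :
    ∃ A : ℝ, 0 ≤ A ∧ ∀ n : ℕ, 1 ≤ n → ∀ (k : ℕ) (f₀ : ℝ), |f₀| ≤ L →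
      coordRisk (coordPrior σ H k) (κ k) (n : ℝ≥0)⁻¹ f₀ ≤ ENNReal.ofReal
        (A * (1 + Real.log n + Real.log (k + 1)) ^ (2 * (1 + ϱ))
          * ((k : ℝ) + 1) ^ (2 * ν) / n) ∧
      ((n : ℝ) ^ (1 / (2 * β + 2 * ν + 1)) < k + 1 →
        coordRisk (coordPrior σ H k) (κ k) (n : ℝ≥0)⁻¹ f₀ ≤ ENNReal.ofReal
          (A * ((k : ℝ) + 1) ^ (-1 - 2 * β)
            + A * (1 + Real.log n + Real.log (k + 1)) ^ (2 * (1 + ϱ)) * f₀ ^ 2)) := by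
  obtain ⟨c, C₀, hc, -, hκb⟩ := hκ
  -- `C ≥ 1` keeps the radius `1 / (C √n)` at most one, and `κ k ≤ C` keeps the ball within the
  -- noise level.
  set C := max C₀ 1 with hC
  have hC1 : 1 ≤ C := le_max_right _ _
  obtain ⟨A₀, hA₀, hball⟩ := exists_smallBall_exponent hH hc₁ hϱ hh hL hσ0 hσ1 hB hσlog hC1
  set m₂ := ∫ x, x ^ 2 ∂H
  have hm₂ : 0 ≤ m₂ := integral_nonneg fun x => sq_nonneg x
  set E := Real.exp (C ^ 2 * B * m₂ / 2 + 1) with hE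
  refine ⟨(8 * A₀ + 56) / c ^ 2 + 2 * E * B * m₂ + (80 * A₀ + 1330), by positivity, ?_⟩
  intro n hn k f₀ hf₀
  have hn1 : (1 : ℝ) ≤ n := by exact_mod_cast hn
  have hn0 : (0 : ℝ) < n := by linarith
  have hv : (n : ℝ≥0)⁻¹ ≠ 0 := by simpa using (by omega : n ≠ 0)
  have hvn : (((n : ℝ≥0)⁻¹ : ℝ≥0) : ℝ) = (n : ℝ)⁻¹ := by simp
  set m : ℝ := (k : ℝ) + 1 with hm
  have hm1 : 1 ≤ m := by linarith [Nat.cast_nonneg (α := ℝ) k]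
  have hm0 : 0 < m := by linarith
  have hκ1 : c * m ^ (-ν) ≤ κ k := (hκb k).1
  have hκ0 : 0 < κ k := lt_of_lt_of_le (by positivity) hκ1
  have hκ2 : κ k ≤ C * m ^ (-ν) := (hκb k).2.trans (by gcongr; exact le_max_left _ _)
  have hκC : κ k ≤ C := hκ2.trans (mul_le_of_le_one_right (by linarith)
    (Real.rpow_le_one_of_one_le_of_nonpos hm1 (by linarith)))
  set ℓp := (1 + Real.log n + Real.log m) ^ (2 * (1 + ϱ)) with hℓp
  have hℓp1 : 1 ≤ ℓp := Real.one_le_rpow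
    (by linarith [Real.log_nonneg hn1, Real.log_nonneg hm1]) (by linarith)
  set I : Set ℝ := {f | |f - f₀| ≤ 1 / (C * √n)} with hIdef
  have hI : MeasurableSet I := measurableSet_le (by fun_prop) measurable_const
  have hIf : ∀ f ∈ I, κ k ^ 2 * (f - f₀) ^ 2 ≤ ((n : ℝ≥0)⁻¹ : ℝ≥0) := by
    intro f hf
    rw [hvn, ← sq_abs (f - f₀)]
    have hf' : |f - f₀| ≤ 1 / (C * √n) := hf
    calc κ k ^ 2 * |f - f₀| ^ 2 ≤ C ^ 2 * (1 / (C * √n)) ^ 2 := by gcongr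
      _ = (n : ℝ)⁻¹ := by
          rw [div_pow, mul_pow, Real.sq_sqrt hn0.le]
          field_simp
  have hΛ := hball n hn k f₀ hf₀
  have hΛ0 : 0 ≤ A₀ * ℓp := by positivity
  have hsq : ∫ f, f ^ 2 ∂(coordPrior σ H k) = σ k ^ 2 * m₂ := integral_sq_coordPrior σ k
  constructor
  · refine (coordRisk_le_parametric _ (κ k) hv hκ0 hI hIf hΛ0 hΛ).trans
      (ENNReal.ofReal_le_ofReal ?_)
    rw [hvn]
    have h1 : (n : ℝ)⁻¹ / κ k ^ 2 ≤ m ^ (2 * ν) / (c ^ 2 * n) := by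
      calc (n : ℝ)⁻¹ / κ k ^ 2 ≤ (n : ℝ)⁻¹ / (c * m ^ (-ν)) ^ 2 := by gcongr
        _ = _ := by
          rw [mul_pow, ← Real.rpow_natCast (m ^ (-ν)), ← Real.rpow_mul hm0.le,
            show -ν * ((2 : ℕ) : ℝ) = -(2 * ν) by push_cast; ring, Real.rpow_neg hm0.le]
          field_simp
    calc (n : ℝ)⁻¹ / κ k ^ 2 * (8 * (A₀ * ℓp) + 56)
        ≤ m ^ (2 * ν) / (c ^ 2 * n) * ((8 * A₀ + 56) * ℓp) := by
          gcongr
          linarith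
      _ = (8 * A₀ + 56) / c ^ 2 * ℓp * m ^ (2 * ν) / n := by field_simp
      _ ≤ _ := by
          gcongr
          have : 0 ≤ 2 * E * B * m₂ := by positivity
          linarith
  · intro hT
    refine (coordRisk_le_prior _ (κ k) hv (integrable_sq_coordPrior hH hh hmom σ k)
      (integral_id_coordPrior hH hh σ k) hκ0 hI hIf hΛ0 hΛ).trans (ENNReal.ofReal_le_ofReal ?_)
    rw [hsq, hvn]
    have hnm : n ≤ m ^ (2 * β + 2 * ν + 1) := by
      have hq0 : 0 < 2 * β + 2 * ν + 1 := by positivity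
      calc (n : ℝ) = ((n : ℝ) ^ (1 / (2 * β + 2 * ν + 1))) ^ (2 * β + 2 * ν + 1) := by
            rw [← Real.rpow_mul hn0.le, one_div_mul_cancel hq0.ne', Real.rpow_one]
        _ ≤ _ := Real.rpow_le_rpow (by positivity) hT.le hq0.le
    -- Beyond the cut-off `n ≤ m ^ (2β + 2ν + 1)`, which exactly offsets the decay of `κ k ^ 2 * σ k
    -- ^ 2`, so the change-of-measure factor stays bounded.
    have hexp : κ k ^ 2 * (σ k ^ 2 * m₂) / (2 * (n : ℝ)⁻¹) + 1 ≤ C ^ 2 * B * m₂ / 2 + 1 := by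
      have h1 : n * (κ k ^ 2 * σ k ^ 2) ≤ C ^ 2 * B := by
        calc n * (κ k ^ 2 * σ k ^ 2)
            ≤ m ^ (2 * β + 2 * ν + 1) * ((C * m ^ (-ν)) ^ 2 * (B * m ^ (-1 - 2 * β))) := by
              gcongr
              exact hσβ k
          _ = C ^ 2 * B * (m ^ (2 * β + 2 * ν + 1) * (m ^ (-ν * 2) * m ^ (-1 - 2 * β))) := by
              rw [mul_pow, ← Real.rpow_two (m ^ (-ν)), ← Real.rpow_mul hm0.le]
              ring
          _ = C ^ 2 * B := by
              rw [← Real.rpow_add hm0, ← Real.rpow_add hm0,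
                show 2 * β + 2 * ν + 1 + (-ν * 2 + (-1 - 2 * β)) = 0 by ring, Real.rpow_zero,
                mul_one]
      have h2 : κ k ^ 2 * (σ k ^ 2 * m₂) / (2 * (n : ℝ)⁻¹)
          = n * (κ k ^ 2 * σ k ^ 2) * m₂ / 2 := by field_simp
      rw [h2]
      gcongr
    have h3 : 2 * Real.exp (κ k ^ 2 * (σ k ^ 2 * m₂) / (2 * (n : ℝ)⁻¹) + 1) * (σ k ^ 2 * m₂)
        ≤ 2 * E * B * m₂ * m ^ (-1 - 2 * β) := by
      calc _ ≤ 2 * E * (B * m ^ (-1 - 2 * β) * m₂) := by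
            have := hσβ k
            have := Real.exp_le_exp.2 hexp
            gcongr
        _ = _ := by ring
    have h4 : f₀ ^ 2 * (80 * (A₀ * ℓp) + 1330) ≤ (80 * A₀ + 1330) * ℓp * f₀ ^ 2 := by
      nlinarith [mul_nonneg (sq_nonneg f₀) (sub_nonneg.2 hℓp1)]
    have h5 : 0 ≤ (8 * A₀ + 56) / c ^ 2 := by positivity
    have h6 : 0 ≤ 2 * E * B * m₂ := by positivity
    refine (add_le_add h3 h4).trans (add_le_add ?_ ?_)
    · gcongr
      linarith
    · refine mul_le_mul_of_nonneg_right (mul_le_mul_of_nonneg_right ?_ (by positivity))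
        (sq_nonneg _)
      linarith

/-- Posterior contraction for heavy-tailed series priors whose scales decay at least as fast as
`k ^ (-1/2 - β)` but not faster than `exp (-B (1 + log k) ^ 2)`. -/
theorem exists_posteriorContracts (hν : 0 ≤ ν) (hκ : HasIllPosedness κ ν) (hH : HasDensity H h)
    (hc₁ : 0 < c₁) (hϱ : 0 ≤ ϱ) (hh : IsHeavyTailed h c₁ ϱ)
    (hmom : Integrable (fun x : ℝ => |x| ^ 2 * h x) volume) (hβ : 0 < β) (hL : 0 < L)
    (hσ0 : ∀ k, 0 < σ k) (hσ1 : ∀ k, σ k ≤ 1)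
    (hB : 0 ≤ B) (hσlog : ∀ k : ℕ, -Real.log (σ k) ≤ B * (1 + Real.log (k + 1)) ^ 2)
    (hσβ : ∀ k : ℕ, σ k ^ 2 ≤ B * ((k : ℝ) + 1) ^ (-1 - 2 * β)) :
    ∃ d : ℝ, 0 < d ∧ ∀ f₀ ∈ sobolevBall β L, PosteriorContracts κ σ H f₀ (rate β ν d) := by
  set p := 2 * (1 + ϱ) with hp
  have hp0 : 0 < p := by positivity
  -- With `d = p` the squared rate carries `log n` to the power `2p` against `p` in the total risk,
  -- leaving `(log n) ^ (-p)`.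
  refine ⟨p, hp0, fun f₀ hf₀ => ?_⟩
  obtain ⟨A, hA, hrisk⟩ := exists_coordRisk_le hν hκ hH hc₁ hϱ hh hmom hβ hL hσ0 hσ1 hB hσlog hσβ
  obtain ⟨K, hK, hsum⟩ := exists_tsum_le_of_cutoff (L := L) hβ hν hp0 hA
  obtain ⟨c, C, hc, hC, hκb⟩ := hκ
  have hm1 : ∀ k : ℕ, (1 : ℝ) ≤ (k : ℝ) + 1 := fun k => by linarith [Nat.cast_nonneg (α := ℝ) k]
  have hκ2 : ∀ k, κ k ^ 2 ≤ C ^ 2 := fun k => by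
    have h0 : 0 ≤ κ k := le_trans (by positivity) (hκb k).1
    have h1 : κ k ≤ C := (hκb k).2.trans (mul_le_of_le_one_right hC.le
      (Real.rpow_le_one_of_one_le_of_nonpos (hm1 k) (by linarith)))
    gcongr
  have hprior : Summable fun k => κ k ^ 2 * ∫ f, f ^ 2 ∂(coordPrior σ H k) := by
    have hs : Summable fun k : ℕ => ((k : ℝ) + 1) ^ (-1 - 2 * β) := by
      have := (summable_nat_add_iff 1).2 (Real.summable_nat_rpow.2 (by linarith : -1 - 2 * β < -1))
      simpa using this
    have hm₂ : 0 ≤ ∫ x, x ^ 2 ∂H := integral_nonneg fun x => sq_nonneg x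
    refine .of_nonneg_of_le (fun k => ?_) (fun k => ?_)
      (hs.mul_left (C ^ 2 * B * ∫ x, x ^ 2 ∂H))
    · rw [integral_sq_coordPrior]; positivity
    · rw [integral_sq_coordPrior]
      calc κ k ^ 2 * (σ k ^ 2 * ∫ x, x ^ 2 ∂H)
          ≤ C ^ 2 * (B * ((k : ℝ) + 1) ^ (-1 - 2 * β) * ∫ x, x ^ 2 ∂H) := by
            exact mul_le_mul (hκ2 k) (mul_le_mul_of_nonneg_right (hσβ k) hm₂) (by positivity)
              (sq_nonneg _)
        _ = _ := by ring
  have hsignal : Summable fun k => (κ k * f₀ k) ^ 2 := by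
    refine .of_nonneg_of_le (fun k => sq_nonneg _) (fun k => ?_) (hf₀.1.mul_left (C ^ 2))
    rw [mul_pow]
    exact mul_le_mul (hκ2 k) (le_mul_of_one_le_left (sq_nonneg _)
      (Real.one_le_rpow (hm1 k) (by positivity))) (sq_nonneg _) (sq_nonneg _)
  have habs : ∀ k, |f₀ k| ≤ L := fun k =>
    abs_le_of_sq_le_sq (sq_le_of_mem_sobolevBall hβ hf₀ k) hL.le
  have hbound : ∀ n : ℕ, 3 ≤ n →
      ∫⁻ X, posterior (model κ n) (prior σ H) X
          {f | ENNReal.ofReal (rate β ν p n) < l2Dist f f₀} ∂(model κ n f₀)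
        ≤ ENNReal.ofReal (K * Real.log n ^ (-p)) := by
    intro n hn
    have hn3 : (3 : ℝ) ≤ n := by exact_mod_cast hn
    have hn0 : (0 : ℝ) < n := by linarith
    have hℓ : 0 < Real.log n := Real.log_pos (by linarith)
    have hrate : 0 < rate β ν p n := mul_pos (Real.rpow_pos_of_pos hℓ _)
      (Real.rpow_pos_of_pos hn0 _)
    refine (lintegral_posterior_le_tsum_coordRisk κ σ H (by omega)
      (integrable_sq_coordPrior hH hh hmom σ) (integral_id_coordPrior hH hh σ) hprior hsignal
      hrate).trans ?_
    have h1 := hsum n hn (fun k => f₀ k ^ 2)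
      (fun k => coordRisk (coordPrior σ H k) (κ k) (n : ℝ≥0)⁻¹ (f₀ k)) (fun k => sq_nonneg _)
      hf₀.1 hf₀.2 (fun k => (hrisk n (by omega) k (f₀ k) (habs k)).1)
      (fun k => (hrisk n (by omega) k (f₀ k) (habs k)).2)
    refine (ENNReal.div_le_div_right h1 _).trans (le_of_eq ?_)
    rw [← ENNReal.ofReal_div_of_pos (by positivity)]
    congr 1
    rw [div_eq_iff (by positivity), rate, mul_pow, ← Real.rpow_natCast (Real.log n ^ p),
      ← Real.rpow_natCast (_ ^ (-β / _)), ← Real.rpow_mul hℓ.le, ← Real.rpow_mul hn0.le]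
    have e1 : Real.log n ^ p = Real.log n ^ (-p) * Real.log n ^ (p * ((2 : ℕ) : ℝ)) := by
      rw [← Real.rpow_add hℓ]
      congr 1
      push_cast
      ring
    have e2 : -(2 * β) / (2 * β + 2 * ν + 1) = -β / (2 * β + 2 * ν + 1) * ((2 : ℕ) : ℝ) := by
      push_cast
      ring
    rw [e1, e2]
    ring
  have hlim : Tendsto (fun n : ℕ => ENNReal.ofReal (K * Real.log n ^ (-p))) atTop (𝓝 0) := by
    have h1 : Tendsto (fun n : ℕ => K * Real.log n ^ (-p)) atTop (𝓝 (K * 0)) :=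
      (((tendsto_rpow_neg_atTop hp0).comp Real.tendsto_log_atTop).comp
        tendsto_natCast_atTop_atTop).const_mul K
    simpa [Function.comp_def] using (ENNReal.continuous_ofReal.tendsto _).comp h1
  refine tendsto_of_tendsto_of_tendsto_of_le_of_le' tendsto_const_nhds hlim
    (.of_forall fun n => zero_le) ?_
  filter_upwards [eventually_ge_atTop 3] with n hn using hbound n hn

end Contraction

end SequenceModel

theorem theorem2
    (ν : ℝ) (hν : 0 ≤ ν) (κ : ℕ → ℝ) (hκ : SequenceModel.HasIllPosedness κ ν)
    (H : Measure ℝ) [IsProbabilityMeasure H] (h : ℝ → ℝ) (hH : SequenceModel.HasDensity H h)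
    (c₁ ϱ : ℝ) (hc₁ : 0 < c₁) (hϱ : 0 ≤ ϱ) (hh : SequenceModel.IsHeavyTailed h c₁ ϱ)
    (hmom : Integrable (fun x : ℝ => |x| ^ 2 * h x) volume)
    (β L : ℝ) (hβ : 0 < β) (hL : 0 < L) :
    (∃ d : ℝ, 0 < d ∧ ∀ f₀ ∈ SequenceModel.sobolevBall β L,
      SequenceModel.PosteriorContracts κ SequenceModel.otScale H f₀
        (SequenceModel.rate β ν d)) ∧
    (∀ α : ℝ, β ≤ α → ∃ d : ℝ, 0 < d ∧ ∀ f₀ ∈ SequenceModel.sobolevBall β L,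
      SequenceModel.PosteriorContracts κ (SequenceModel.htScale α) H f₀
        (SequenceModel.rate β ν d)) := by
  have hm1 : ∀ k : ℕ, (1 : ℝ) ≤ (k : ℝ) + 1 := fun k => by linarith [Nat.cast_nonneg (α := ℝ) k]
  have hm0 : ∀ k : ℕ, (0 : ℝ) < (k : ℝ) + 1 := fun k => by positivity
  have hlog : ∀ k : ℕ, 0 ≤ Real.log ((k : ℝ) + 1) := fun k => Real.log_nonneg (hm1 k)
  constructor
  · refine SequenceModel.exists_posteriorContracts hν hκ hH hc₁ hϱ hh hmom hβ hL
      -- With `t = log (k + 1)`, the variance bound needs `(1 + 2β) t - 2t² ≤ (1 + 2β)²`.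
      (B := Real.exp ((1 + 2 * β) ^ 2))
      (fun k => Real.exp_pos _) (fun k => ?_) (Real.exp_pos _).le (fun k => ?_) (fun k => ?_)
    · rw [SequenceModel.otScale, Real.exp_le_one_iff]
      linarith [sq_nonneg (Real.log ((k : ℝ) + 1))]
    · have h1 : 1 ≤ Real.exp ((1 + 2 * β) ^ 2) := Real.one_le_exp (sq_nonneg _)
      rw [SequenceModel.otScale, Real.log_exp, neg_neg]
      nlinarith [hlog k, sq_nonneg (Real.log ((k : ℝ) + 1))]
    · rw [SequenceModel.otScale, ← Real.exp_nat_mul, Real.rpow_def_of_pos (hm0 k), ← Real.exp_add,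
        Real.exp_le_exp]
      push_cast
      nlinarith [sq_nonneg (Real.log ((k : ℝ) + 1) - (1 + 2 * β)),
        sq_nonneg (Real.log ((k : ℝ) + 1))]
  · intro α hα
    refine SequenceModel.exists_posteriorContracts hν hκ hH hc₁ hϱ hh hmom hβ hL
      -- `1 + α` covers both the logarithmic slope `1/2 + α` and the constant `1` in the variance
      -- bound, where `α ≥ β` enters.
      (B := 1 + α) (fun k => Real.rpow_pos_of_pos (hm0 k) _) (fun k => ?_) (by linarith)
      (fun k => ?_) (fun k => ?_)
    · exact Real.rpow_le_one_of_one_le_of_nonpos (hm1 k) (by linarith)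
    · rw [SequenceModel.htScale, Real.log_rpow (hm0 k)]
      nlinarith [hlog k, sq_nonneg (Real.log ((k : ℝ) + 1))]
    · rw [SequenceModel.htScale, ← Real.rpow_natCast, ← Real.rpow_mul (hm0 k).le]
      calc ((k : ℝ) + 1) ^ ((-1 / 2 - α) * ((2 : ℕ) : ℝ)) ≤ ((k : ℝ) + 1) ^ (-1 - 2 * β) :=
            Real.rpow_le_rpow_of_exponent_le (hm1 k) (by push_cast; linarith)
        _ ≤ _ := le_mul_of_one_le_left (Real.rpow_pos_of_pos (hm0 k) _).le (by linarith)
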